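/- \textbf{Setting.} Fix circuit parameters $\boldsymbol\Omega=(\omega_{\rm b},C_{\rm f},L_{\rm f},R_{\rm f},L,R)\in\mathbb R^6_{>0}$, design constants $K_{\rm VC},K_{\rm CC},\mu_{\rm d},\mu_{\rm q},\Gamma_{\rm d},\Gamma_{\rm q},\varepsilon,\omega_{\rm pc},\omega_{\rm qc},c,I_{\max}>0$, $\xi_{\rm p},\xi_{\rm q}>1$, saturation levels $\overline P,\overline Q\in(0,+\infty]$, and $\omega_0,V_0,P_0,Q_0,K_{\rm P},K_{\rm Q}\in\mathbb R$. The state is $(\boldsymbol x,z_{\rm d},z_{\rm q})$ with $\boldsymbol x=(v_{\rm c,d},v_{\rm c,q},i_{\rm t,d},i_{\rm t,q},i_{\rm g,d},i_{\rm g,q},q_1,q_2,p_1,p_2)\in\mathbb R^{10}$; write $\boldsymbol v_{\rm c}=(v_{\rm c,d},v_{\rm c,q})$, $\boldsymbol i_{\rm t}=(i_{\rm t,d},i_{\rm t,q})$, and let $\boldsymbol x'\in\mathbb R^8$ be $\boldsymbol x$ without the components $i_{\rm t,d},i_{\rm t,q}$. Put $p=v_{\rm c,d}i_{\rm g,d}+v_{\rm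 c,q}i_{\rm g,q}$, $q=v_{\rm c,q}i_{\rm g,d}-v_{\rm c,d}i_{\rm g,q}$, $\omega=\omega_0+K_{\rm P}(P_0-p_1)$, $v^{\rm r}_{\rm c,d}=V_0+K_{\rm Q}(Q_0-q_1)$, and $\operatorname{sat}_X(y)=\max\{-X,\min\{y,X\}\}$. Given the grid voltage $(v_{\rm g,d},v_{\rm g,q})$ and the terminal voltage $\boldsymbol v_{\rm t}=(v_{\rm t,d},v_{\rm t,q})$, the plant is \begin{align*} \dot v_{\rm c,d}&=\omega_{\rm b}\omega v_{\rm c,q}+\tfrac{\omega_{\rm b}}{C_{\rm f}}(i_{\rm t,d}-i_{\rm g,d}),& \dot v_{\rm c,q}&=-\omega_{\rm b}\omega v_{\rm c,d}+\tfrac{\omega_{\rm b}}{C_{\rm f}}(i_{\rm t,q}-i_{\rm g,q}),\\ \dot i_{\rm t,d}&=\omega_{\rm b}\omega i_{\rm t,q}+\tfrac{\omega_{\rm b}}{L_{\rm f}}(v_{\rm t,d}-v_{\rm c,d})-\tfrac{\omega_{\rm b}R_{\rm f}}{L_{\rm f}}i_{\rm t,d},& \dot i_{\rm t,q}&=-\omega_{\rm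 b}\omega i_{\rm t,d}+\tfrac{\omega_{\rm b}}{L_{\rm f}}(v_{\rm t,q}-v_{\rm c,q})-\tfrac{\omega_{\rm b}R_{\rm f}}{L_{\rm f}}i_{\rm t,q},\\ \dot i_{\rm g,d}&=\omega_{\rm b}\omega i_{\rm g,q}+\tfrac{\omega_{\rm b}}{L}(v_{\rm c,d}-v_{\rm g,d})-\tfrac{\omega_{\rm b}R}{L}i_{\rm g,d},& \dot i_{\rm g,q}&=-\omega_{\rm b}\omega i_{\rm g,d}+\tfrac{\omega_{\rm b}}{L}(v_{\rm c,q}-v_{\rm g,q})-\tfrac{\omega_{\rm b}R}{L}i_{\rm g,q},\\ \dot q_1&=q_2,&\dot q_2&=-2\xi_{\rm q}\omega_{\rm qc}q_2-\omega_{\rm qc}^2\big(q_1-\operatorname{sat}_{\overline Q}(q)\big),\\ \dot p_1&=p_2,&\dot p_2&=-2\xi_{\rm p}\omega_{\rm pc}p_2-\omega_{\rm pc}^2\big(p_1-\operatorname{sat}_{\overline P}(p)\big). \end{align*} \textbf{Nominal controller (DADS-BS).} Let $e_{\rm d}=v_{\rm c,d}-v^{\rm r}_{\rm c,d}$, $i^{\rm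 r}_{\rm t,d}=i_{\rm g,d}-C_{\rm f}\omega v_{\rm c,q}-\frac{C_{\rm f}K_{\rm Q}}{\omega_{\rm b}}q_2-\frac{C_{\rm f}K_{\rm VC}}{\omega_{\rm b}}e_{\rm d}$, $i^{\rm r}_{\rm t,q}=i_{\rm g,q}+C_{\rm f}\omega v_{\rm c,d}-\frac{C_{\rm f}K_{\rm VC}}{\omega_{\rm b}}v_{\rm c,q}$, and \begin{align*} u_{\rm d}&=-\Big(K_{\rm CC}+\tfrac{(1+e^{z_{\rm d}})\omega_{\rm b}^2}{4\mu_{\rm d}}(1+i_{\rm g,d}^2+v_{\rm c,d}^2)\Big)(i_{\rm t,d}-i^{\rm r}_{\rm t,d})-\tfrac{\omega_{\rm b}}{C_{\rm f}}e_{\rm d},\\ u_{\rm q}&=-\Big(K_{\rm CC}+\tfrac{(1+e^{z_{\rm q}})\omega_{\rm b}^2}{4\mu_{\rm q}}(1+i_{\rm g,q}^2+v_{\rm c,q}^2)\Big)(i_{\rm t,q}-i^{\rm r}_{\rm t,q})-\tfrac{\omega_{\rm b}}{C_{\rm f}}v_{\rm c,q},\\ v^{\rm n}_{\rm t,d}&=\tfrac{L_{\rm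 f}}{\omega_{\rm b}}\Big[-2\omega_{\rm b}\omega(i_{\rm t,q}-i_{\rm g,q})+\tfrac{\omega_{\rm b}R_{\rm f}}{L_{\rm f}}i_{\rm t,d}+\omega_{\rm b}\big(\tfrac1{L_{\rm f}}+\omega^2C_{\rm f}\big)v_{\rm c,d}+C_{\rm f}K_{\rm P}p_2v_{\rm c,q}-K_{\rm VC}(i_{\rm t,d}-i^{\rm r}_{\rm t,d})\\ &\qquad+\tfrac{C_{\rm f}K_{\rm VC}^2}{\omega_{\rm b}}e_{\rm d}+\tfrac{2\xi_{\rm q}\omega_{\rm qc}K_{\rm Q}C_{\rm f}}{\omega_{\rm b}}q_2+\tfrac{\omega_{\rm qc}^2K_{\rm Q}C_{\rm f}}{\omega_{\rm b}}\big(q_1-\operatorname{sat}_{\overline Q}(q)\big)+u_{\rm d}\Big],\\ v^{\rm n}_{\rm t,q}&=\tfrac{L_{\rm f}}{\omega_{\rm b}}\Big[2\omega_{\rm b}\omega(i_{\rm t,d}-i_{\rm g,d})+\tfrac{\omega_{\rm b}R_{\rm f}}{L_{\rm f}}i_{\rm t,q}+\omega_{\rm b}\big(\tfrac1{L_{\rm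 f}}+C_{\rm f}\omega^2+\tfrac{C_{\rm f}K_{\rm VC}^2}{\omega_{\rm b}^2}\big)v_{\rm c,q}-C_{\rm f}K_{\rm P}p_2v_{\rm c,d}-K_{\rm VC}(i_{\rm t,q}-i^{\rm r}_{\rm t,q})+u_{\rm q}\Big], \end{align*} with adaptive gains $\dot z_\ell=\Gamma_\ell e^{-z_\ell}\max\{W_\ell-\varepsilon,0\}$ for $\ell\in\{{\rm d},{\rm q}\}$, where $W_{\rm d}=\frac12e_{\rm d}^2+\frac12(i_{\rm t,d}-i^{\rm r}_{\rm t,d})^2$ and $W_{\rm q}=\frac12v_{\rm c,q}^2+\frac12(i_{\rm t,q}-i^{\rm r}_{\rm t,q})^2$. \textbf{Safety filter.} With $h=I_{\max}^2-\|\boldsymbol i_{\rm t}\|^2$, $\boldsymbol v^{\rm n}_{\rm t}=(v^{\rm n}_{\rm t,d},v^{\rm n}_{\rm t,q})$, $A=\begin{bmatrix}-\frac{R_{\rm f}}{L_{\rm f}}\omega_{\rm b}&\omega_{\rm b}\omega\\-\omega_{\rm b}\omega&-\frac{R_{\rm f}}{L_{\rm f}}\omega_{\rm b}\end{bmatrix}$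 and \[\eta=-2\boldsymbol i_{\rm t}^\top A\boldsymbol i_{\rm t}+\tfrac{2\omega_{\rm b}}{L_{\rm f}}\boldsymbol i_{\rm t}^\top\boldsymbol v_{\rm c}-\tfrac{2\omega_{\rm b}}{L_{\rm f}}\boldsymbol i_{\rm t}^\top\boldsymbol v^{\rm n}_{\rm t}+c\,h,\] the implemented voltage is $\boldsymbol v_{\rm t}=\boldsymbol v^{\rm n}_{\rm t}$ if $\eta\ge0$, and $\boldsymbol v_{\rm t}=\boldsymbol v^{\rm n}_{\rm t}+\frac{L_{\rm f}}{2\omega_{\rm b}}\frac{\eta}{\|\boldsymbol i_{\rm t}\|^2}\boldsymbol i_{\rm t}$ otherwise. The safe set is $\mathcal C=\{\boldsymbol x: i_{\rm t,d}^2+i_{\rm t,q}^2\le I_{\max}^2\}$. Along a solution, the ON episodes are the maximal intervals contained in $\{t\ge0:\eta(t)<0\}$; $N_\eta\in\mathbb N\cup\{\infty\}$ is their number and $T_\eta\in[0,\infty]$ their total length. \textbf{Theorem.} There exist a continuous function $B_{2}:\mathbb R^{10}\times\mathbb R_+\times\mathbb R_+\to\mathbb R_+$ and a function $B_{3}:\mathbb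 R^{10}\times\mathbb R\times\mathbb R\times\mathbb R_+\times\mathbb R_+\times\mathbb N\times\mathbb R_+\to\mathbb R_+$ (depending on the fixed parameters) such that for all $v_{\rm g,d},v_{\rm g,q}\in L^\infty(\mathbb R_+;\mathbb R)$, all $\boldsymbol x(0)\in\mathcal C$ and all $z_{\rm d}(0),z_{\rm q}(0)\in\mathbb R$, the closed loop has a unique absolutely continuous solution on $[0,\infty)$ with this initial condition, and for all $t\ge0$ \[\sqrt{i_{\rm t,d}(t)^2+i_{\rm t,q}(t)^2}\le I_{\max},\qquad \|\boldsymbol x'(t)\|\le B_2\big(\boldsymbol x(0),\|v_{\rm g,d}\|_\infty,\|v_{\rm g,q}\|_\infty\big).\] Moreover, whenever $N\in\mathbb N$ and $T\in[0,\infty)$ satisfy $N_\eta\le N$ and $T_\eta\le T$ for this solution, then for each $\ell\in\{{\rm d},{\rm q}\}$ the gain $z_\ell$ is non-decreasing, $\lim_{s\to\infty}z_\ell(s)$ exists and is finite, and for all $t\ge0$ \[z_\ell(0)\le z_\ell(t)\le\lim_{s\to\infty}z_\ell(s)\le B_3\big(\boldsymbol x(0),z_{\rm d}(0),z_{\rm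 q}(0),\|v_{\rm g,d}\|_\infty,\|v_{\rm g,q}\|_\infty,N,T\big).\] -/

import Mathlib

open scoped NNReal ENNReal Matrix
open MeasureTheory Set Filter Topology

noncomputable section

namespace GFM

/-- The constant physical parameters `Ω = (ω_b, C_f, L_f, R_f, L, R)`, all positive. -/
structure Circuit where
  ωb : ℝ
  Cf : ℝ
  Lf : ℝ
  Rf : ℝ
  L : ℝ
  R : ℝ
  ωb_pos : 0 < ωb
  Cf_pos : 0 < Cf
  Lf_pos : 0 < Lf
  Rf_pos : 0 < Rf
  L_pos : 0 < L
  R_pos : 0 < R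

/-- Design parameters of the DADS-BS controller, the power filters and the safety filter,
with the setpoints and the droop coefficients. The saturation thresholds lie in `(0, +∞]`. -/
structure Design where
  KVC : ℝ
  KCC : ℝ
  μd : ℝ
  μq : ℝ
  Γd : ℝ
  Γq : ℝ
  ε : ℝ
  ωpc : ℝ
  ωqc : ℝ
  ξp : ℝ
  ξq : ℝ
  Pbar : EReal
  Qbar : EReal
  ω₀ : ℝ
  V₀ : ℝ
  P₀ : ℝ
  Q₀ : ℝ
  KP : ℝ
  KQ : ℝ
  Imax : ℝ
  /-- the gain of the linear barrier condition `ḣ ≥ -c h` -/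
  c : ℝ
  KVC_pos : 0 < KVC
  KCC_pos : 0 < KCC
  μd_pos : 0 < μd
  μq_pos : 0 < μq
  Γd_pos : 0 < Γd
  Γq_pos : 0 < Γq
  ε_pos : 0 < ε
  ωpc_pos : 0 < ωpc
  ωqc_pos : 0 < ωqc
  one_lt_ξp : 1 < ξp
  one_lt_ξq : 1 < ξq
  Pbar_pos : 0 < Pbar
  Qbar_pos : 0 < Qbar
  Imax_pos : 0 < Imax
  c_pos : 0 < c

/-- The physical state
`x = (v_cd, v_cq, i_td, i_tq, i_gd, i_gq, q₁, q₂, p₁, p₂) ∈ ℝ¹⁰` (Euclidean norm). -/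
abbrev State := EuclideanSpace ℝ (Fin 10)

/-- The closed-loop state `(x, z_d, z_q)`. -/
abbrev FullState := State × ℝ × ℝ

namespace State

def vcd (x : State) : ℝ := x 0
def vcq (x : State) : ℝ := x 1
def itd (x : State) : ℝ := x 2
def itq (x : State) : ℝ := x 3
def igd (x : State) : ℝ := x 4
def igq (x : State) : ℝ := x 5
def q₁ (x : State) : ℝ := x 6
def q₂ (x : State) : ℝ := x 7
def p₁ (x : State) : ℝ := x 8
def p₂ (x : State) : ℝ := x 9

/-- PCC voltage vector. -/
def vc (x : State) : Fin 2 → ℝ := ![x.vcd, x.vcq]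

/-- Terminal current vector. -/
def it (x : State) : Fin 2 → ℝ := ![x.itd, x.itq]

/-- Instantaneous active power. -/
def p (x : State) : ℝ := x.vcd * x.igd + x.vcq * x.igq

/-- Instantaneous reactive power. -/
def q (x : State) : ℝ := x.vcq * x.igd - x.vcd * x.igq

/-- The states other than the terminal current,
`x' = (v_cd, v_cq, i_gd, i_gq, q₁, q₂, p₁, p₂) ∈ ℝ⁸` (Euclidean norm). -/
def rest (x : State) : EuclideanSpace ℝ (Fin 8) :=
  !₂[x.vcd, x.vcq, x.igd, x.igq, x.q₁, x.q₂, x.p₁, x.p₂]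

end State

/-- Saturation at the level `X ∈ (0, +∞]`. -/
def sat (X : EReal) (y : ℝ) : ℝ :=
  open Classical in
  if X < (y : EReal) then X.toReal
  else if (y : EReal) < -X then -X.toReal
  else y

/-! ### Droop laws -/

/-- Reference for the d-axis PCC voltage; the q-axis reference is zero. -/
def vcdRef (D : Design) (x : State) : ℝ := D.V₀ + D.KQ * (D.Q₀ - x.q₁)

/-- Per-unit electrical frequency. -/
def freq (D : Design) (x : State) : ℝ := D.ω₀ + D.KP * (D.P₀ - x.p₁)

/-! ### The DADS-BS controller -/

/-- Reference for the d-axis terminal current. -/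
def itdRef (Ω : Circuit) (D : Design) (x : State) : ℝ :=
  x.igd - Ω.Cf * freq D x * x.vcq - Ω.Cf * D.KQ / Ω.ωb * x.q₂
    - Ω.Cf * D.KVC / Ω.ωb * (x.vcd - vcdRef D x)

/-- Reference for the q-axis terminal current. -/
def itqRef (Ω : Circuit) (D : Design) (x : State) : ℝ :=
  x.igq + Ω.Cf * freq D x * x.vcd - Ω.Cf * D.KVC / Ω.ωb * x.vcq

def ud (Ω : Circuit) (D : Design) (x : State) (zd : ℝ) : ℝ :=
  -(D.KCC + (1 + Real.exp zd) * Ω.ωb ^ 2 / (4 * D.μd) * (1 + x.igd ^ 2 + x.vcd ^ 2))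
      * (x.itd - itdRef Ω D x)
    - Ω.ωb / Ω.Cf * (x.vcd - vcdRef D x)

def uq (Ω : Circuit) (D : Design) (x : State) (zq : ℝ) : ℝ :=
  -(D.KCC + (1 + Real.exp zq) * Ω.ωb ^ 2 / (4 * D.μq) * (1 + x.igq ^ 2 + x.vcq ^ 2))
      * (x.itq - itqRef Ω D x)
    - Ω.ωb / Ω.Cf * x.vcq

/-- Nominal d-axis terminal voltage. -/
def vtdNom (Ω : Circuit) (D : Design) (x : State) (zd : ℝ) : ℝ :=
  Ω.Lf / Ω.ωb *
    (-2 * Ω.ωb * freq D x * (x.itq - x.igq) + Ω.ωb * Ω.Rf / Ω.Lf * x.itd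
      + Ω.ωb * (1 / Ω.Lf + freq D x ^ 2 * Ω.Cf) * x.vcd + Ω.Cf * D.KP * x.p₂ * x.vcq
      - D.KVC * (x.itd - itdRef Ω D x) + Ω.Cf * D.KVC ^ 2 / Ω.ωb * (x.vcd - vcdRef D x)
      + 2 * D.ξq * D.ωqc * D.KQ * Ω.Cf / Ω.ωb * x.q₂
      + D.ωqc ^ 2 * D.KQ * Ω.Cf / Ω.ωb * (x.q₁ - sat D.Qbar x.q)
      + ud Ω D x zd)

/-- Nominal q-axis terminal voltage. -/
def vtqNom (Ω : Circuit) (D : Design) (x : State) (zq : ℝ) : ℝ :=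
  Ω.Lf / Ω.ωb *
    (2 * Ω.ωb * freq D x * (x.itd - x.igd) + Ω.ωb * Ω.Rf / Ω.Lf * x.itq
      + Ω.ωb * (1 / Ω.Lf + Ω.Cf * freq D x ^ 2 + Ω.Cf * D.KVC ^ 2 / Ω.ωb ^ 2) * x.vcq
      - Ω.Cf * D.KP * x.p₂ * x.vcd
      - D.KVC * (x.itq - itqRef Ω D x)
      + uq Ω D x zq)

/-- The DADS-BS control as a nominal terminal-voltage vector. -/
def vtNom (Ω : Circuit) (D : Design) (y : FullState) : Fin 2 → ℝ :=
  ![vtdNom Ω D y.1 y.2.1, vtqNom Ω D y.1 y.2.2]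

/-- The d-axis energy signal driving the adaptation. -/
def Wd (Ω : Circuit) (D : Design) (x : State) : ℝ :=
  1 / 2 * (x.vcd - vcdRef D x) ^ 2 + 1 / 2 * (x.itd - itdRef Ω D x) ^ 2

/-- The q-axis energy signal driving the adaptation. -/
def Wq (Ω : Circuit) (D : Design) (x : State) : ℝ :=
  1 / 2 * x.vcq ^ 2 + 1 / 2 * (x.itq - itqRef Ω D x) ^ 2

/-! ### The safety filter -/

/-- The current-limiting barrier function. -/
def barrier (D : Design) (x : State) : ℝ := D.Imax ^ 2 - x.it ⬝ᵥ x.it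

/-- The safe set `𝒞`. -/
def safeSet (D : Design) : Set State := {x | x.itd ^ 2 + x.itq ^ 2 ≤ D.Imax ^ 2}

/-- The matrix `A(x)` of the terminal-current dynamics. -/
def A (Ω : Circuit) (D : Design) (x : State) : Matrix (Fin 2) (Fin 2) ℝ :=
  !![-(Ω.Rf / Ω.Lf * Ω.ωb), Ω.ωb * freq D x;
     -(Ω.ωb * freq D x), -(Ω.Rf / Ω.Lf * Ω.ωb)]

/-- `η(x, vn)`, the slack of the barrier condition under the control `vn`. -/
def eta (Ω : Circuit) (D : Design) (x : State) (vn : Fin 2 → ℝ) : ℝ :=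
  -2 * (x.it ⬝ᵥ (A Ω D x *ᵥ x.it)) + 2 * Ω.ωb / Ω.Lf * (x.it ⬝ᵥ x.vc)
    - 2 * Ω.ωb / Ω.Lf * (x.it ⬝ᵥ vn) + D.c * barrier D x

/-- The safety filter: the implemented terminal voltage for the nominal voltage `vn`. -/
def safetyFilter (Ω : Circuit) (D : Design) (x : State) (vn : Fin 2 → ℝ) : Fin 2 → ℝ :=
  open Classical in
  if 0 ≤ eta Ω D x vn then vn
  else vn + (Ω.Lf / (2 * Ω.ωb) * (eta Ω D x vn / (x.it ⬝ᵥ x.it))) • x.it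

/-! ### Dynamics -/

/-- Right-hand side of the circuit and power-filter dynamics, with terminal voltage `vt` and
grid voltage `(vgd, vgq)`. -/
def plantField (Ω : Circuit) (D : Design) (vgd vgq : ℝ) (vt : Fin 2 → ℝ) (x : State) : State :=
  !₂[Ω.ωb * freq D x * x.vcq + Ω.ωb / Ω.Cf * (x.itd - x.igd),
     -Ω.ωb * freq D x * x.vcd + Ω.ωb / Ω.Cf * (x.itq - x.igq),
     Ω.ωb * freq D x * x.itq + Ω.ωb / Ω.Lf * (vt 0 - x.vcd) - Ω.ωb * Ω.Rf / Ω.Lf * x.itd,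
     -Ω.ωb * freq D x * x.itd + Ω.ωb / Ω.Lf * (vt 1 - x.vcq) - Ω.ωb * Ω.Rf / Ω.Lf * x.itq,
     Ω.ωb * freq D x * x.igq + Ω.ωb / Ω.L * (x.vcd - vgd) - Ω.ωb * Ω.R / Ω.L * x.igd,
     -Ω.ωb * freq D x * x.igd + Ω.ωb / Ω.L * (x.vcq - vgq) - Ω.ωb * Ω.R / Ω.L * x.igq,
     x.q₂,
     -2 * D.ξq * D.ωqc * x.q₂ - D.ωqc ^ 2 * (x.q₁ - sat D.Qbar x.q),
     x.p₂,
     -2 * D.ξp * D.ωpc * x.p₂ - D.ωpc ^ 2 * (x.p₁ - sat D.Pbar x.p)]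

/-- Right-hand side of the closed loop with the safety-filtered DADS-BS control. -/
def closedLoopField (Ω : Circuit) (D : Design) (vgd vgq : ℝ) (y : FullState) : FullState :=
  (plantField Ω D vgd vgq (safetyFilter Ω D y.1 (vtNom Ω D y)) y.1,
   D.Γd * Real.exp (-y.2.1) * max (Wd Ω D y.1 - D.ε) 0,
   D.Γq * Real.exp (-y.2.2) * max (Wq Ω D y.1 - D.ε) 0)

/-- `y` is an absolutely continuous solution of the closed loop on `[0, ∞)`: it is absolutely
continuous on every `[0, T]` and satisfies the differential equation for almost every time. Only
the values of `y`, `vgd`, `vgq` at nonnegative times matter. -/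
structure IsSolution (Ω : Circuit) (D : Design) (vgd vgq : ℝ → ℝ) (y : ℝ → FullState) :
    Prop where
  absCont : ∀ T : ℝ, 0 ≤ T → AbsolutelyContinuousOnInterval y 0 T
  ode : ∀ᵐ t ∂(volume.restrict (Ici (0 : ℝ))),
    HasDerivAt y (closedLoopField Ω D (vgd t) (vgq t) (y t)) t

/-! ### Grid voltage signals -/

/-- `v ∈ L^∞(ℝ₊; ℝ)`. -/
def IsBoundedSignal (v : ℝ → ℝ) : Prop := MemLp v ⊤ (volume.restrict (Ici (0 : ℝ)))

/-- `‖v‖_∞`, the essential supremum of `|v|` on `ℝ₊`. -/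
def supNorm (v : ℝ → ℝ) : ℝ≥0 := (eLpNorm v ⊤ (volume.restrict (Ici (0 : ℝ)))).toNNReal

/-! ### Activation of the safety filter -/

/-- The set of times at which the safety filter is active along `y`. -/
def onSet (Ω : Circuit) (D : Design) (y : ℝ → FullState) : Set ℝ :=
  {t | 0 ≤ t ∧ eta Ω D (y t).1 (vtNom Ω D (y t)) < 0}

/-- The ON episodes: the maximal intervals contained in the ON set. -/
def episodes (Ω : Circuit) (D : Design) (y : ℝ → FullState) : Set (Set ℝ) :=
  (fun t => ordConnectedComponent (onSet Ω D y) t) '' onSet Ω D y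

/-- `N_η`, the number of ON episodes, possibly infinite. -/
def episodeCount (Ω : Circuit) (D : Design) (y : ℝ → FullState) : ℕ∞ :=
  (episodes Ω D y).encard

/-- `T_η`, the sum of the lengths of the ON episodes, possibly infinite. -/
def totalOnTime (Ω : Circuit) (D : Design) (y : ℝ → FullState) : ℝ≥0∞ :=
  ∑' J : episodes Ω D y, volume (J : Set ℝ)

/-- The asserted behaviour of an adaptive gain: `z` is non-decreasing on `[0, ∞)` and converges
to a finite limit, with `z 0 ≤ z t ≤ lim z ≤ B` for all `t ≥ 0`. -/
def GainBoundedBy (z : ℝ → ℝ) (B : ℝ) : Prop :=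
  MonotoneOn z (Ici 0) ∧
    ∃ l : ℝ, Tendsto z atTop (𝓝 l) ∧ (∀ t : ℝ, 0 ≤ t → z 0 ≤ z t ∧ z t ≤ l) ∧ l ≤ B

end GFM

end

/-! ### Absolutely continuous functions -/

namespace AbsolutelyContinuousOnInterval

/-! The physical states are bounded by a chain of estimates that never look at the nominal
controller or the gains. Safety comes first: the filter gives (‖i_t‖²)' = c h - η + min(η, 0) ≤ c h,
so ‖i_t‖ ≤ I_max whatever the nominal voltage is (`current_sq_le`). The terminal current is then a
bounded input to the passive capacitor and grid inductor. Their energy, corrected by a small cross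
term -δ v·i that makes the capacitor voltage dissipate as well, satisfies E' ≤ -κE + const; the
rotation by ω cancels, so no bound on the frequency is needed (`exists_storage`,
`exists_grid_bound`). Now the powers are bounded, and an overdamped filter is a cascade of two
stable first-order filters (`exists_filter_bound`). This yields B₂.

For well-posedness, the filtered field is locally Lipschitz: η = c I_max² > 0 where the current
vanishes, so the correction is identically zero near its apparent singularity
(`locallyLipschitz_correction`). The grid voltage enters additively, and subtracting its primitive
leaves an equation with continuous right-hand side. Blow-up is excluded by the bounds above and by
(e^z)' = Γ max(W - ε, 0), which makes e^z grow at most linearly (`exists_global_forcedSolution`,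
`exists_solution`).

For the gains, backstepping with nonlinear damping gives W' ≤ -σW + ϑ/(1 + e^z) while the filter is
off (`ae_Wd_deriv_le`, `ae_Wq_deriv_le`). Once e^z ≥ ϑ/(σε), the disturbance is at most σε and the
excess w = max(W - ε, 0) decays at rate σ outside the ON episodes. Inside them only 0 ≤ w ≤ M is
known, but N episodes raise w by at most NM in total and contribute at most MT to its integral, so
∫w ≤ MT + (N + 1)M/σ (`AbsolutelyContinuousOnInterval.integral_le_of_decay_off`). Hence e^z exceeds
the larger of its initial value and the threshold by at most Γ times this (`exp_gain_le`), and the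
monotone gain converges. -/

theorem comp_lipschitzOnWith {X Y : Type*} [PseudoMetricSpace X] [PseudoMetricSpace Y]
    {f : ℝ → X} {g : X → Y} {a b : ℝ} {K : ℝ≥0} {s : Set X}
    (hf : AbsolutelyContinuousOnInterval f a b) (hg : LipschitzOnWith K g s)
    (hs : MapsTo f (uIcc a b) s) : AbsolutelyContinuousOnInterval (fun t => g (f t)) a b := by
  rw [absolutelyContinuousOnInterval_iff] at hf ⊢
  intro ε hε
  obtain ⟨δ, hδ, h⟩ := hf (ε / (K + 1)) (by positivity)
  refine ⟨δ, hδ, fun E hE hEδ => ?_⟩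
  have h1 := h E hE hEδ
  calc ∑ i ∈ Finset.range E.1, dist (g (f (E.2 i).1)) (g (f (E.2 i).2))
      ≤ ∑ i ∈ Finset.range E.1, (K + 1) * dist (f (E.2 i).1) (f (E.2 i).2) := by
        refine Finset.sum_le_sum fun i hi => ?_
        refine (hg.dist_le_mul _ (hs (hE.1 i hi).1) _ (hs (hE.1 i hi).2)).trans ?_
        gcongr
        simp
    _ = (K + 1) * ∑ i ∈ Finset.range E.1, dist (f (E.2 i).1) (f (E.2 i).2) := by
        rw [Finset.mul_sum]
    _ < (K + 1) * (ε / (K + 1)) := by gcongr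
    _ = ε := by field_simp

/-- The image of the interval is compact, and a locally Lipschitz map has a single Lipschitz
constant on a compact set. -/
theorem comp_locallyLipschitz {X Y : Type*} [PseudoMetricSpace X] [PseudoMetricSpace Y]
    {f : ℝ → X} {g : X → Y} {a b : ℝ} (hf : AbsolutelyContinuousOnInterval f a b)
    (hfc : ContinuousOn f (uIcc a b)) (hg : LocallyLipschitz g) :
    AbsolutelyContinuousOnInterval (fun t => g (f t)) a b := by
  obtain ⟨K, hK⟩ := (hg.locallyLipschitzOn (s := f '' uIcc a b)).exists_lipschitzOnWith_of_compact
    (isCompact_uIcc.image_of_continuousOn hfc)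
  exact hf.comp_lipschitzOnWith hK (mapsTo_image _ _)

theorem congr {X : Type*} [PseudoMetricSpace X] {f g : ℝ → X} {a b : ℝ}
    (hf : AbsolutelyContinuousOnInterval f a b) (h : EqOn f g (uIcc a b)) :
    AbsolutelyContinuousOnInterval g a b := by
  rw [absolutelyContinuousOnInterval_iff] at hf ⊢
  intro ε hε
  obtain ⟨δ, hδ, H⟩ := hf ε hε
  refine ⟨δ, hδ, fun E hE hEδ => lt_of_eq_of_lt ?_ (H E hE hEδ)⟩
  refine Finset.sum_congr rfl fun i hi => ?_
  rw [h (hE.1 i hi).1, h (hE.1 i hi).2]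

/-- An absolutely continuous function with nonpositive derivative almost everywhere does not
increase. -/
theorem le_of_ae_deriv_nonpos {f : ℝ → ℝ} {a b : ℝ} (hf : AbsolutelyContinuousOnInterval f a b)
    (hab : a ≤ b) (h : ∀ᵐ t, t ∈ Icc a b → deriv f t ≤ 0) : f b ≤ f a := by
  have h1 : ∫ t in a..b, deriv f t ≤ 0 := by
    rw [intervalIntegral.integral_of_le hab]
    refine integral_nonpos_of_ae ?_
    rw [EventuallyLE, ae_restrict_iff' measurableSet_Ioc]
    filter_upwards [h] with t ht h'
    exact ht (Ioc_subset_Icc_self h')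
  rw [hf.integral_deriv_eq_sub] at h1
  linarith

/-- Grönwall's inequality `f' ≤ -k f + C` for absolutely continuous functions. -/
theorem le_max_of_ae_deriv_le {f : ℝ → ℝ} {a b k C : ℝ}
    (hf : AbsolutelyContinuousOnInterval f a b) (hab : a ≤ b) (hk : 0 < k)
    (h : ∀ᵐ t, t ∈ Icc a b → ∃ d, HasDerivAt f d t ∧ d ≤ -k * f t + C) :
    f b ≤ max (f a) (C / k) := by
  have hexp : AbsolutelyContinuousOnInterval (fun t => Real.exp (k * t)) a b :=
    ContDiffOn.absolutelyContinuousOnInterval (by fun_prop)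
  have hsub : AbsolutelyContinuousOnInterval (fun t => f t - C / k) a b :=
    hf.comp_lipschitzOnWith (g := fun x => x - C / k) (K := 1) (s := univ)
      (LipschitzWith.of_dist_le_mul (by simp)).lipschitzOnWith (mapsTo_univ _ _)
  -- Integrating factor: e^{kt}(f - C/k) has nonpositive derivative almost everywhere.
  have key : Real.exp (k * b) * (f b - C / k) ≤ Real.exp (k * a) * (f a - C / k) := by
    refine (hexp.mul hsub).le_of_ae_deriv_nonpos hab ?_
    filter_upwards [h] with t ht hmem
    obtain ⟨d, hd, hle⟩ := ht hmem
    have h1 : HasDerivAt (fun t => Real.exp (k * t)) (Real.exp (k * t) * k) t := by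
      simpa using ((hasDerivAt_id t).const_mul k).exp
    have h2 := h1.mul (hd.sub_const (C / k))
    rw [h2.deriv]
    have h3 : Real.exp (k * t) * k * (f t - C / k) + Real.exp (k * t) * d
        = Real.exp (k * t) * (d + k * f t - C) := by field_simp; ring
    rw [h3]
    exact mul_nonpos_of_nonneg_of_nonpos (Real.exp_pos _).le (by linarith)
  by_contra! hcon
  obtain ⟨h1, h2⟩ := max_lt_iff.1 hcon
  have h3 : Real.exp (k * a) ≤ Real.exp (k * b) := Real.exp_le_exp.2 (by gcongr)
  have h4 : 0 < Real.exp (k * a) := Real.exp_pos _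
  nlinarith [mul_le_mul_of_nonneg_right h3 (sub_nonneg.2 h2.le),
    mul_lt_mul_of_pos_left (sub_lt_sub_right h1 (C / k)) h4]

theorem abs_le_max_of_ae_hasDerivAt {f s : ℝ → ℝ} {a b k C : ℝ}
    (hf : AbsolutelyContinuousOnInterval f a b) (hab : a ≤ b) (hk : 0 < k)
    (h : ∀ᵐ t, t ∈ Icc a b → HasDerivAt f (-k * f t + s t) t) (hs : ∀ t ∈ Icc a b, |s t| ≤ C) :
    |f b| ≤ max |f a| (C / k) := by
  rw [abs_le']
  constructor
  · refine (hf.le_max_of_ae_deriv_le hab hk (C := C) ?_).trans (max_le_max (le_abs_self _) le_rfl)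
    filter_upwards [h] with t ht hmem
    exact ⟨_, ht hmem, by linarith [(abs_le.1 (hs t hmem)).2]⟩
  · have := hf.neg.le_max_of_ae_deriv_le hab hk (C := C) (by
      filter_upwards [h] with t ht hmem
      exact ⟨_, (ht hmem).neg, by simp only [Pi.neg_apply]; linarith [(abs_le.1 (hs t hmem)).1]⟩)
    exact this.trans (max_le_max (neg_le_abs _) le_rfl)

/-- `f' ≤ C` almost everywhere implies `f b ≤ f a + C (b - a)`. -/
theorem le_add_of_ae_deriv_le {f : ℝ → ℝ} {a b C : ℝ}
    (hf : AbsolutelyContinuousOnInterval f a b) (hab : a ≤ b)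
    (h : ∀ᵐ t, t ∈ Icc a b → ∃ d, HasDerivAt f d t ∧ d ≤ C) : f b ≤ f a + C * (b - a) := by
  have hlin : AbsolutelyContinuousOnInterval (fun t => C * t) a b :=
    ContDiffOn.absolutelyContinuousOnInterval (by fun_prop)
  have := (hf.sub hlin).le_of_ae_deriv_nonpos hab (by
    filter_upwards [h] with t ht hmem
    obtain ⟨d, hd, hle⟩ := ht hmem
    have h2 := hd.sub ((hasDerivAt_id t).const_mul C)
    have h3 := h2.deriv
    simp only [id] at h3
    change deriv (f - fun t => C * t) t ≤ 0
    rw [show (f - fun t => C * t) = (f - fun y => C * y) from rfl, h3]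
    linarith)
  simp only [Pi.sub_apply] at this
  linarith

theorem le_of_ae_hasDerivAt_nonneg {f : ℝ → ℝ} {a b : ℝ}
    (hf : AbsolutelyContinuousOnInterval f a b) (hab : a ≤ b)
    (h : ∀ᵐ t, t ∈ Icc a b → ∃ d, HasDerivAt f d t ∧ 0 ≤ d) : f a ≤ f b := by
  have := hf.neg.le_of_ae_deriv_nonpos hab (by
    filter_upwards [h] with t ht hmem
    obtain ⟨d, hd, hle⟩ := ht hmem
    rw [hd.neg.deriv]
    linarith)
  simpa using this

end AbsolutelyContinuousOnInterval

/-! ### Locally Lipschitz differential equations with an additive forcing -/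

section ODE

variable {E : Type*} [NormedAddCommGroup E] [NormedSpace ℝ E]

/-- `y` is an absolutely continuous solution of `y' = F y + u` on `[0, T]`. -/
structure IsForcedSolutionOn (F : E → E) (u : ℝ → E) (T : ℝ) (y : ℝ → E) : Prop where
  absCont : AbsolutelyContinuousOnInterval y 0 T
  ode : ∀ᵐ t, t ∈ Icc 0 T → HasDerivAt y (F (y t) + u t) t

namespace IsForcedSolutionOn

variable {F : E → E} {u : ℝ → E} {T τ : ℝ} {y y₁ y₂ : ℝ → E}

theorem mono (h : IsForcedSolutionOn F u T y) (hτ : 0 ≤ τ) (hτT : τ ≤ T) :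
    IsForcedSolutionOn F u τ y where
  absCont := h.absCont.mono (by
    rw [uIcc_of_le hτ, uIcc_of_le (hτ.trans hτT)]; exact Icc_subset_Icc_right hτT)
  ode := by
    filter_upwards [h.ode] with t ht hmem
    exact ht ⟨hmem.1, hmem.2.trans hτT⟩

theorem continuousOn (h : IsForcedSolutionOn F u T y) (hT : 0 ≤ T) : ContinuousOn y (Icc 0 T) := by
  have := h.absCont.uniformContinuousOn.continuousOn
  rwa [uIcc_of_le hT] at this

/-- The forcing cancels in y₁ - y₂, whose almost-everywhere derivative G is therefore continuous. So
the difference is the integral of G, has a one-sided derivative at every time, and the classical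
Grönwall argument applies. -/
theorem eqOn [CompleteSpace E] (hF : LocallyLipschitz F) (hT : 0 ≤ T)
    (h₁ : IsForcedSolutionOn F u T y₁)
    (h₂ : IsForcedSolutionOn F u T y₂) (h0 : y₁ 0 = y₂ 0) : EqOn y₁ y₂ (Icc 0 T) := by
  have c₁ := h₁.continuousOn hT
  have c₂ := h₂.continuousOn hT
  set G : ℝ → E := fun t => F (y₁ t) - F (y₂ t) with hG
  have cG : ContinuousOn G (Icc 0 T) :=
    (hF.continuous.comp_continuousOn c₁).sub (hF.continuous.comp_continuousOn c₂)
  have iG : IntervalIntegrable G volume 0 T := by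
    apply ContinuousOn.intervalIntegrable
    rwa [uIcc_of_le hT]
  have dI : ∀ t ∈ Icc 0 T,
      HasDerivWithinAt (fun s => ∫ r in (0 : ℝ)..s, G r) (G t) (Icc 0 T) t := by
    intro t ht
    have : Fact (t ∈ Icc 0 T) := ⟨ht⟩
    refine intervalIntegral.integral_hasDerivWithinAt_right ?_
      (cG.stronglyMeasurableAtFilter_nhdsWithin measurableSet_Icc t) (cG t ht)
    exact iG.mono_set (by
      rw [uIcc_of_le hT, uIcc_of_le ht.1]; exact Icc_subset_Icc_right ht.2)
  have acI : AbsolutelyContinuousOnInterval (fun s => ∫ r in (0 : ℝ)..s, G r) 0 T := by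
    obtain ⟨C, hC⟩ := isCompact_Icc.exists_bound_of_continuousOn cG
    refine LipschitzOnWith.absolutelyContinuousOnInterval (K := C.toNNReal) ?_
    rw [uIcc_of_le hT]
    refine (convex_Icc (0 : ℝ) T).lipschitzOnWith_of_nnnorm_hasDerivWithin_le dI fun t ht => ?_
    rw [← NNReal.coe_le_coe, coe_nnnorm]
    exact (hC t ht).trans (Real.le_coe_toNNReal C)
  -- At the endpoints the integral is differentiable only within the interval; they form a null set.
  have hne : ∀ᵐ t : ℝ, t ∉ ({0, T} : Set ℝ) :=
    measure_eq_zero_iff_ae_notMem.1 (((Set.finite_singleton T).insert 0).measure_zero _)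
  obtain ⟨c, hc⟩ := ((h₁.absCont.sub h₂.absCont).sub acI).const_of_ae_hasDerivAt_zero (by
    filter_upwards [h₁.ode, h₂.ode, hne] with t ht₁ ht₂ hn hmem
    rw [uIcc_of_le hT] at hmem
    simp only [mem_insert_iff, mem_singleton_iff, not_or] at hn
    have hI := (dI t hmem).hasDerivAt
      (Icc_mem_nhds (lt_of_le_of_ne hmem.1 (Ne.symm hn.1)) (lt_of_le_of_ne hmem.2 hn.2))
    have := ((ht₁ hmem).sub (ht₂ hmem)).sub hI
    convert! this using 1
    simp [hG])
  rw [uIcc_of_le hT] at hc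
  have hc0 : c = 0 := by
    rw [← hc 0 ⟨le_rfl, hT⟩]; simp [h0]
  have heq : ∀ t ∈ Icc 0 T, (y₁ - y₂) t = ∫ r in (0 : ℝ)..t, G r := by
    intro t ht
    have := hc t ht
    rw [hc0, Pi.sub_apply, sub_eq_zero] at this
    exact this
  have dD : ∀ t ∈ Icc 0 T, HasDerivWithinAt (y₁ - y₂) (G t) (Icc 0 T) t := fun t ht =>
    (dI t ht).congr heq (heq t ht)
  -- One Lipschitz constant on the compact union of both trajectories.
  obtain ⟨K, hK⟩ :=
    (hF.locallyLipschitzOn (s := y₁ '' Icc 0 T ∪ y₂ '' Icc 0 T)).exists_lipschitzOnWith_of_compact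
      ((isCompact_Icc.image_of_continuousOn c₁).union (isCompact_Icc.image_of_continuousOn c₂))
  have hz := eq_zero_of_abs_deriv_le_mul_abs_self_of_eq_zero_right (f := y₁ - y₂) (f' := G)
    (K := K) (a := 0) (b := T) (c₁.sub c₂)
    (fun t ht => (dD t ⟨ht.1, ht.2.le⟩).mono_of_mem_nhdsWithin (Icc_mem_nhdsGE_of_mem ht))
    (by simp [h0])
    (fun t ht => by
      have := hK.norm_sub_le (Or.inl ⟨t, ⟨ht.1, ht.2.le⟩, rfl⟩) (Or.inr ⟨t, ⟨ht.1, ht.2.le⟩, rfl⟩)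
      simpa [hG] using this)
  intro t ht
  have := hz t ht
  rwa [Pi.sub_apply, sub_eq_zero] at this

end IsForcedSolutionOn

/-- A locally Lipschitz field can be replaced by a bounded one that agrees with it on a ball. -/
theorem LocallyLipschitz.exists_bounded_eqOn_closedBall [FiniteDimensional ℝ E] {F : E → E}
    (hF : LocallyLipschitz F) {R : ℝ} (hR : 0 < R) :
    ∃ G : E → E, LocallyLipschitz G ∧ EqOn G F (Metric.closedBall 0 R) ∧
      ∃ L : ℝ≥0, ∀ x, ‖G x‖ ≤ L := by
  let χ : ContDiffBump (0 : E) := ⟨R, R + 1, hR, by linarith⟩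
  have hχ : LocallyLipschitz (χ : E → ℝ) :=
    ContDiff.locallyLipschitz (𝕂 := ℝ) (χ.contDiff (n := 1))
  have hsm : LocallyLipschitz (fun p : ℝ × E => p.1 • p.2) :=
    ContDiff.locallyLipschitz (𝕂 := ℝ) (by fun_prop)
  have hG : LocallyLipschitz (fun x => χ x • F x) := hsm.comp (hχ.prodMk hF)
  refine ⟨fun x => χ x • F x, hG, fun x hx => ?_, ?_⟩
  · simp only
    rw [χ.one_of_mem_closedBall hx, one_smul]
  · have hc : HasCompactSupport (fun x => χ x • F x) := χ.hasCompactSupport.smul_right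
    obtain ⟨C, hC⟩ := hc.exists_bound_of_continuous hG.continuous
    exact ⟨C.toNNReal, fun x => (hC x).trans (Real.le_coe_toNNReal C)⟩

variable [FiniteDimensional ℝ E] {F : E → E} {u V : ℝ → E}

/-- Solvability on `[0, T]` for a bounded locally Lipschitz field. -/
theorem exists_isForcedSolutionOn_of_bounded (hF : LocallyLipschitz F) {L : ℝ≥0}
    (hL : ∀ x, ‖F x‖ ≤ L) {T : ℝ} (hT : 0 ≤ T) (hV : AbsolutelyContinuousOnInterval V 0 T)
    (hVu : ∀ᵐ t, t ∈ Icc 0 T → HasDerivAt V (u t) t) (hV0 : V 0 = 0) (y₀ : E) :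
    ∃ y, IsForcedSolutionOn F u T y ∧ y 0 = y₀ := by
  have : CompleteSpace E := FiniteDimensional.complete ℝ E
  have : ProperSpace E := FiniteDimensional.proper ℝ E
  have cV : ContinuousOn V (Icc 0 T) := by
    have := hV.uniformContinuousOn.continuousOn
    rwa [uIcc_of_le hT] at this
  obtain ⟨CV, hCV⟩ := isCompact_Icc.exists_bound_of_continuousOn cV
  -- A curve of speed at most L moves no further than L T, so Picard–Lindelöf with this radius
  -- covers all of [0, T].
  set a : ℝ≥0 := L * T.toNNReal with ha
  obtain ⟨K, hK⟩ := (hF.locallyLipschitzOn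
    (s := Metric.closedBall y₀ (a + CV))).exists_lipschitzOnWith_of_compact
      (isCompact_closedBall _ _)
  have hmaps : ∀ t ∈ Icc 0 T, ∀ w ∈ Metric.closedBall y₀ a,
      w + V t ∈ Metric.closedBall y₀ (a + CV) := by
    intro t ht w hw
    rw [mem_closedBall_iff_norm] at hw ⊢
    calc ‖w + V t - y₀‖ = ‖(w - y₀) + V t‖ := by congr 1; abel
      _ ≤ ‖w - y₀‖ + ‖V t‖ := norm_add_le _ _
      _ ≤ a + CV := add_le_add hw (hCV t ht)
  -- The substitution w = y - V removes the merely measurable forcing: w' = F(w + V t) is continuous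
  -- in time.
  have hPL : IsPicardLindelof (fun t w => F (w + V t)) (tmin := 0) (tmax := T)
      ⟨0, le_rfl, hT⟩ y₀ a 0 L K := by
    refine ⟨fun t ht => ?_, fun w _ => ?_, fun t _ w _ => hL _, ?_⟩
    · refine LipschitzOnWith.of_dist_le_mul fun w₁ hw₁ w₂ hw₂ => ?_
      have := hK.dist_le_mul _ (hmaps t ht w₁ hw₁) _ (hmaps t ht w₂ hw₂)
      simpa using this
    · exact hF.continuous.comp_continuousOn (continuousOn_const.add cV)
    · simp [ha, hT]
  obtain ⟨w, hw0, hw⟩ := hPL.exists_eq_forall_mem_Icc_hasDerivWithinAt₀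
  have acw : AbsolutelyContinuousOnInterval w 0 T := by
    refine LipschitzOnWith.absolutelyContinuousOnInterval (K := L) ?_
    rw [uIcc_of_le hT]
    exact (convex_Icc (0 : ℝ) T).lipschitzOnWith_of_nnnorm_hasDerivWithin_le hw
      fun t _ => hL _
  have hne : ∀ᵐ t : ℝ, t ∉ ({0, T} : Set ℝ) :=
    measure_eq_zero_iff_ae_notMem.1 (((Set.finite_singleton T).insert 0).measure_zero _)
  refine ⟨w + V, ⟨acw.add hV, ?_⟩, by simpa [hV0] using hw0⟩
  filter_upwards [hVu, hne] with t ht hn hmem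
  simp only [mem_insert_iff, mem_singleton_iff, not_or] at hn
  exact ((hw t hmem).hasDerivAt (Icc_mem_nhds (lt_of_le_of_ne hmem.1 (Ne.symm hn.1))
    (lt_of_le_of_ne hmem.2 hn.2))).add (ht hmem)

/-- Solvability on `[0, T]` from an a priori bound. -/
theorem exists_isForcedSolutionOn_of_apriori (hF : LocallyLipschitz F) {T R : ℝ} (hT : 0 ≤ T)
    (hV : AbsolutelyContinuousOnInterval V 0 T)
    (hVu : ∀ᵐ t, t ∈ Icc 0 T → HasDerivAt V (u t) t) (hV0 : V 0 = 0) (y₀ : E)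
    (hR : ∀ τ, 0 ≤ τ → τ ≤ T → ∀ y, IsForcedSolutionOn F u τ y → y 0 = y₀ → ‖y τ‖ ≤ R) :
    ∃ y, IsForcedSolutionOn F u T y ∧ y 0 = y₀ := by
  -- The truncation radius exceeds the a priori bound by 1, so a solution of the truncated equation
  -- that obeys the bound stays strictly inside the ball, where G = F.
  obtain ⟨G, hG, hGF, L, hL⟩ := hF.exists_bounded_eqOn_closedBall
    (R := max R ‖y₀‖ + 1) (by positivity)
  obtain ⟨y, hy, hy0⟩ := exists_isForcedSolutionOn_of_bounded hG hL hT hV hVu hV0 y₀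
  have cy := hy.continuousOn hT
  -- The ball condition is asked only before τ, the single time τ being null; this lets it be used
  -- at the first exit time.
  have agree : ∀ τ, 0 ≤ τ → τ ≤ T → (∀ t ∈ Ico 0 τ, ‖y t‖ ≤ max R ‖y₀‖ + 1) →
      IsForcedSolutionOn F u τ y := by
    intro τ h0 hτ hb
    refine ⟨(hy.mono h0 hτ).absCont, ?_⟩
    filter_upwards [(hy.mono h0 hτ).ode, measure_eq_zero_iff_ae_notMem.1
      (measure_singleton (μ := volume) τ)] with t ht hne hmem
    rw [← hGF (mem_closedBall_zero_iff.2 (hb t ⟨hmem.1, lt_of_le_of_ne hmem.2 hne⟩))]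
    exact ht hmem
  have key : ∀ t ∈ Icc 0 T, ‖y t‖ < max R ‖y₀‖ + 1 := by
    by_contra! hcon
    obtain ⟨t₁, ht₁, hyt₁⟩ := hcon
    have hS : IsCompact (Icc 0 T ∩ y ⁻¹' {x | max R ‖y₀‖ + 1 ≤ ‖x‖}) :=
      isCompact_Icc.of_isClosed_subset
        (cy.preimage_isClosed_of_isClosed isClosed_Icc
          (isClosed_le continuous_const continuous_norm)) inter_subset_left
    -- At the first time t of reaching the enlarged radius, y still solves the original equation on
    -- [0, t], so the a priori bound contradicts the exit.
    obtain ⟨t, ⟨ht, hyt⟩, hmin⟩ := hS.exists_isLeast ⟨t₁, ht₁, hyt₁⟩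
    have hbt : ‖y t‖ ≤ R := by
      refine hR t ht.1 ht.2 y (agree t ht.1 ht.2 fun s hs => ?_) hy0
      by_contra! hlt
      exact absurd (hmin ⟨⟨hs.1, hs.2.le.trans ht.2⟩, hlt.le⟩) (not_le.2 hs.2)
    have : max R ‖y₀‖ + 1 ≤ ‖y t‖ := hyt
    linarith [le_max_left R ‖y₀‖]
  exact ⟨y, agree T hT le_rfl fun t ht => (key t ⟨ht.1, ht.2.le⟩).le, hy0⟩

/-- Global solvability from a priori bounds on bounded intervals. -/
theorem exists_global_forcedSolution (hF : LocallyLipschitz F)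
    (hV : ∀ T, 0 ≤ T → AbsolutelyContinuousOnInterval V 0 T)
    (hVu : ∀ᵐ t, 0 ≤ t → HasDerivAt V (u t) t) (hV0 : V 0 = 0) (y₀ : E)
    (hR : ∀ T, 0 ≤ T → ∃ R, ∀ τ, 0 ≤ τ → τ ≤ T → ∀ y, IsForcedSolutionOn F u τ y → y 0 = y₀ →
      ‖y τ‖ ≤ R) :
    ∃ y, (∀ T, 0 ≤ T → IsForcedSolutionOn F u T y) ∧ y 0 = y₀ := by
  have : CompleteSpace E := FiniteDimensional.complete ℝ E
  have hex : ∀ n : ℕ, ∃ y, IsForcedSolutionOn F u n y ∧ y 0 = y₀ := fun n => by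
    obtain ⟨R, hR'⟩ := hR n n.cast_nonneg
    exact exists_isForcedSolutionOn_of_apriori hF n.cast_nonneg (hV n n.cast_nonneg)
      (by filter_upwards [hVu] with t ht hmem using ht hmem.1) hV0 y₀ hR'
  choose Y hY hY0 using hex
  have hYeq : ∀ m n : ℕ, m ≤ n → EqOn (Y m) (Y n) (Icc 0 m) := fun m n hmn =>
    (hY m).eqOn hF m.cast_nonneg ((hY n).mono m.cast_nonneg (by exact_mod_cast hmn))
      ((hY0 m).trans (hY0 n).symm)
  -- The solutions on [0, n] are compatible by uniqueness, so they glue.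
  set y : ℝ → E := fun t => Y ⌈t⌉₊ t with hy
  have hyY : ∀ n : ℕ, EqOn (Y n) y (Icc 0 n) := fun n t ht =>
    (hYeq _ _ (Nat.ceil_le.2 ht.2) ⟨ht.1, Nat.le_ceil t⟩).symm
  have hsol : ∀ n : ℕ, IsForcedSolutionOn F u n y := fun n => by
    refine ⟨(hY n).absCont.congr (by rw [uIcc_of_le n.cast_nonneg]; exact hyY n), ?_⟩
    have hne : ∀ᵐ t : ℝ, t ∉ ({0, (n : ℝ)} : Set ℝ) :=
      measure_eq_zero_iff_ae_notMem.1 (((Set.finite_singleton _).insert 0).measure_zero _)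
    filter_upwards [(hY n).ode, hne] with t ht hn hmem
    simp only [mem_insert_iff, mem_singleton_iff, not_or] at hn
    have hnhds : Icc 0 (n : ℝ) ∈ 𝓝 t := Icc_mem_nhds (lt_of_le_of_ne hmem.1 (Ne.symm hn.1))
      (lt_of_le_of_ne hmem.2 hn.2)
    rw [← hyY n hmem]
    exact (ht hmem).congr_of_eventuallyEq
      (Filter.eventuallyEq_of_mem hnhds fun s hs => (hyY n hs).symm)
  refine ⟨y, fun T hT => (hsol ⌈T⌉₊).mono hT (Nat.le_ceil T), ?_⟩
  simp [hy, hY0]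

end ODE

/-! ### Calculus of locally Lipschitz functions -/

attribute [fun_prop] LocallyLipschitz

namespace LocallyLipschitz

@[fun_prop]
theorem fun_id {X : Type*} [PseudoMetricSpace X] : LocallyLipschitz fun x : X => x :=
  LocallyLipschitz.id

@[fun_prop]
theorem fun_const {X Y : Type*} [PseudoMetricSpace X] [PseudoMetricSpace Y] (y : Y) :
    LocallyLipschitz fun _ : X => y := LocallyLipschitz.const y

@[fun_prop]
theorem fun_comp {X Y Z : Type*} [PseudoMetricSpace X] [PseudoMetricSpace Y]
    [PseudoMetricSpace Z] {f : Y → Z} {g : X → Y} (hf : LocallyLipschitz f)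
    (hg : LocallyLipschitz g) : LocallyLipschitz fun x => f (g x) := hf.comp hg

@[fun_prop]
theorem fun_fst {X Y Z : Type*} [PseudoMetricSpace X] [PseudoMetricSpace Y]
    [PseudoMetricSpace Z] {f : X → Y × Z} (hf : LocallyLipschitz f) :
    LocallyLipschitz fun x => (f x).1 := LipschitzWith.prod_fst.locallyLipschitz.comp hf

@[fun_prop]
theorem fun_snd {X Y Z : Type*} [PseudoMetricSpace X] [PseudoMetricSpace Y]
    [PseudoMetricSpace Z] {f : X → Y × Z} (hf : LocallyLipschitz f) :
    LocallyLipschitz fun x => (f x).2 := LipschitzWith.prod_snd.locallyLipschitz.comp hf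

variable {X : Type*} [PseudoMetricSpace X] {f g : X → ℝ}

@[fun_prop]
theorem fun_add (hf : LocallyLipschitz f) (hg : LocallyLipschitz g) :
    LocallyLipschitz fun x => f x + g x :=
  (ContDiff.locallyLipschitz (𝕂 := ℝ) (f := fun p : ℝ × ℝ => p.1 + p.2) (by fun_prop)).comp
    (hf.prodMk hg)

@[fun_prop]
theorem fun_sub (hf : LocallyLipschitz f) (hg : LocallyLipschitz g) :
    LocallyLipschitz fun x => f x - g x :=
  (ContDiff.locallyLipschitz (𝕂 := ℝ) (f := fun p : ℝ × ℝ => p.1 - p.2) (by fun_prop)).comp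
    (hf.prodMk hg)

@[fun_prop]
theorem fun_mul (hf : LocallyLipschitz f) (hg : LocallyLipschitz g) :
    LocallyLipschitz fun x => f x * g x :=
  (ContDiff.locallyLipschitz (𝕂 := ℝ) (f := fun p : ℝ × ℝ => p.1 * p.2) (by fun_prop)).comp
    (hf.prodMk hg)

@[fun_prop]
theorem fun_div_const (hf : LocallyLipschitz f) (c : ℝ) : LocallyLipschitz fun x => f x / c := by
  simpa only [div_eq_mul_inv] using hf.fun_mul (LocallyLipschitz.const c⁻¹)

@[fun_prop]
theorem fun_neg (hf : LocallyLipschitz f) : LocallyLipschitz fun x => -f x :=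
  (ContDiff.locallyLipschitz (𝕂 := ℝ) (f := fun p : ℝ => -p) (by fun_prop)).comp hf

@[fun_prop]
theorem fun_pow (hf : LocallyLipschitz f) (n : ℕ) : LocallyLipschitz fun x => f x ^ n :=
  (ContDiff.locallyLipschitz (𝕂 := ℝ) (f := fun p : ℝ => p ^ n) (by fun_prop)).comp hf

@[fun_prop]
theorem fun_exp (hf : LocallyLipschitz f) : LocallyLipschitz fun x => Real.exp (f x) :=
  (ContDiff.locallyLipschitz (𝕂 := ℝ) Real.contDiff_exp).comp hf

@[fun_prop]
theorem fun_max (hf : LocallyLipschitz f) (c : ℝ) : LocallyLipschitz fun x => max (f x) c :=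
  hf.max_const c

theorem of_eventuallyEq {Y : Type*} [PseudoMetricSpace Y] {f : X → Y}
    (h : ∀ x, ∃ g : X → Y, (∃ K, ∃ t ∈ 𝓝 x, LipschitzOnWith K g t) ∧ f =ᶠ[𝓝 x] g) :
    LocallyLipschitz f := by
  intro x
  obtain ⟨g, ⟨K, t, ht, hK⟩, hfg⟩ := h x
  refine ⟨K, t ∩ {x | f x = g x}, inter_mem ht hfg, fun a ha b hb => ?_⟩
  rw [show f a = g a from ha.2, show f b = g b from hb.2]
  exact hK ha.1 hb.1

theorem euclidean {n : ℕ} {f : X → EuclideanSpace ℝ (Fin n)}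
    (h : ∀ i, LocallyLipschitz fun x => f x i) : LocallyLipschitz f := by
  have hpi : LocallyLipschitz (fun x i => f x i) := by
    intro x
    choose K t ht hK using fun i => h i x
    refine ⟨∑ i, K i, ⋂ i, t i, Filter.iInter_mem.2 ht, fun a ha b hb => ?_⟩
    rw [edist_pi_le_iff]
    intro i
    refine (hK i (mem_iInter.1 ha i) (mem_iInter.1 hb i)).trans ?_
    gcongr
    exact Finset.single_le_sum (f := K) (fun _ _ => zero_le) (Finset.mem_univ i)
  exact (PiLp.lipschitzWith_toLp 2 (fun _ : Fin n => ℝ)).locallyLipschitz.comp hpi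

end LocallyLipschitz

namespace GFM

open LocallyLipschitz

/-! ### Regularity of the closed loop -/

theorem locallyLipschitz_coord (i : Fin 10) : LocallyLipschitz fun x : State => x i :=
  ContDiff.locallyLipschitz (𝕂 := ℝ) (by fun_prop)

/-- Bounds the filter inputs by the raw powers, which makes the argument uniform in the thresholds
and valid at +∞. -/
theorem abs_sat_le (X : EReal) (hX : 0 < X) (y : ℝ) : |sat X y| ≤ |y| := by
  induction X with
  | bot => simp at hX
  | top => simp [sat]
  | coe a =>
    have ha : 0 < a := by exact_mod_cast hX
    simp only [sat, EReal.coe_lt_coe_iff, EReal.toReal_coe, ← EReal.coe_neg]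
    split_ifs with h1 h2
    · rw [abs_of_pos ha, abs_of_pos (ha.trans h1)]; exact h1.le
    · rw [abs_neg, abs_of_pos ha, abs_of_neg (by linarith)]; linarith
    · exact le_rfl

theorem locallyLipschitz_sat (X : EReal) (hX : 0 < X) : LocallyLipschitz (sat X) := by
  induction X with
  | bot => simp at hX
  | top =>
    have : sat ⊤ = id := by ext y; simp [sat]
    rw [this]; exact LocallyLipschitz.id
  | coe a =>
    have ha : 0 < a := by exact_mod_cast hX
    have : sat a = fun y => max (-a) (min y a) := by
      ext y
      simp only [sat, EReal.coe_lt_coe_iff, EReal.toReal_coe, ← EReal.coe_neg]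
      split_ifs with h1 h2
      · rw [min_eq_right h1.le, max_eq_right (by linarith)]
      · rw [min_eq_left (by linarith), max_eq_left h2.le]
      · rw [min_eq_left (by linarith), max_eq_right (by linarith)]
    rw [this]
    exact (LocallyLipschitz.id.min_const a).const_max (-a)

@[fun_prop]
theorem locallyLipschitz_vcd : LocallyLipschitz State.vcd := locallyLipschitz_coord 0
@[fun_prop]
theorem locallyLipschitz_vcq : LocallyLipschitz State.vcq := locallyLipschitz_coord 1
@[fun_prop]
theorem locallyLipschitz_itd : LocallyLipschitz State.itd := locallyLipschitz_coord 2
@[fun_prop]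
theorem locallyLipschitz_itq : LocallyLipschitz State.itq := locallyLipschitz_coord 3
@[fun_prop]
theorem locallyLipschitz_igd : LocallyLipschitz State.igd := locallyLipschitz_coord 4
@[fun_prop]
theorem locallyLipschitz_igq : LocallyLipschitz State.igq := locallyLipschitz_coord 5
@[fun_prop]
theorem locallyLipschitz_q₁ : LocallyLipschitz State.q₁ := locallyLipschitz_coord 6
@[fun_prop]
theorem locallyLipschitz_q₂ : LocallyLipschitz State.q₂ := locallyLipschitz_coord 7
@[fun_prop]
theorem locallyLipschitz_p₁ : LocallyLipschitz State.p₁ := locallyLipschitz_coord 8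
@[fun_prop]
theorem locallyLipschitz_p₂ : LocallyLipschitz State.p₂ := locallyLipschitz_coord 9

variable (Ω : Circuit) (D : Design)

@[fun_prop]
theorem locallyLipschitz_freq : LocallyLipschitz (freq D) := by
  unfold freq
  fun_prop

@[fun_prop]
theorem locallyLipschitz_vcdRef : LocallyLipschitz (vcdRef D) := by
  unfold vcdRef
  fun_prop

@[fun_prop]
theorem locallyLipschitz_p : LocallyLipschitz State.p :=
  ((locallyLipschitz_coord 0).fun_mul (locallyLipschitz_coord 4)).fun_add
    ((locallyLipschitz_coord 1).fun_mul (locallyLipschitz_coord 5))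

@[fun_prop]
theorem locallyLipschitz_q : LocallyLipschitz State.q :=
  ((locallyLipschitz_coord 1).fun_mul (locallyLipschitz_coord 4)).fun_sub
    ((locallyLipschitz_coord 0).fun_mul (locallyLipschitz_coord 5))

@[fun_prop]
theorem locallyLipschitz_sat_p : LocallyLipschitz (sat D.Pbar) :=
  locallyLipschitz_sat _ D.Pbar_pos

@[fun_prop]
theorem locallyLipschitz_sat_q : LocallyLipschitz (sat D.Qbar) :=
  locallyLipschitz_sat _ D.Qbar_pos

@[fun_prop]
theorem locallyLipschitz_itdRef : LocallyLipschitz (itdRef Ω D) := by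
  unfold itdRef
  fun_prop

@[fun_prop]
theorem locallyLipschitz_itqRef : LocallyLipschitz (itqRef Ω D) := by
  unfold itqRef
  fun_prop

@[fun_prop]
theorem locallyLipschitz_Wd : LocallyLipschitz (Wd Ω D) := by
  unfold Wd
  fun_prop

@[fun_prop]
theorem locallyLipschitz_Wq : LocallyLipschitz (Wq Ω D) := by
  unfold Wq
  fun_prop

@[fun_prop]
theorem locallyLipschitz_vtdNom :
    LocallyLipschitz fun y : FullState => vtdNom Ω D y.1 y.2.1 := by
  unfold vtdNom ud
  fun_prop

@[fun_prop]
theorem locallyLipschitz_vtqNom :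
    LocallyLipschitz fun y : FullState => vtqNom Ω D y.1 y.2.2 := by
  unfold vtqNom uq
  fun_prop

theorem it_dotProduct_it (x : State) : x.it ⬝ᵥ x.it = x.itd ^ 2 + x.itq ^ 2 := by
  simp [State.it]; ring

/-- The frequency terms of `A` are skew-symmetric and drop out of the quadratic form. -/
theorem eta_eq (x : State) (v : Fin 2 → ℝ) :
    eta Ω D x v = 2 * (Ω.Rf / Ω.Lf * Ω.ωb) * (x.itd ^ 2 + x.itq ^ 2)
      + 2 * Ω.ωb / Ω.Lf * (x.itd * x.vcd + x.itq * x.vcq)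
      - 2 * Ω.ωb / Ω.Lf * (x.itd * v 0 + x.itq * v 1)
      + D.c * (D.Imax ^ 2 - (x.itd ^ 2 + x.itq ^ 2)) := by
  rw [eta, barrier, it_dotProduct_it]
  simp [State.it, State.vc, A, Matrix.mulVec, dotProduct, Fin.sum_univ_two]
  ring

/-- The barrier slack of the nominal control as a function of the full state. -/
noncomputable def slack (y : FullState) : ℝ := eta Ω D y.1 (vtNom Ω D y)

@[fun_prop]
theorem locallyLipschitz_slack : LocallyLipschitz (slack Ω D) := by
  unfold slack
  simp only [eta_eq, vtNom, Matrix.cons_val_zero, Matrix.cons_val_one]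
  fun_prop

/-- The scalar gain of the safety correction. -/
noncomputable def correction (y : FullState) : ℝ :=
  min (slack Ω D y) 0 / (y.1.itd ^ 2 + y.1.itq ^ 2)

/-- At zero current only c·I_max² survives in η, so the filter is inactive near the point where its
formula would divide by zero. -/
theorem slack_pos_of_current_eq_zero {y : FullState} (h : y.1.itd ^ 2 + y.1.itq ^ 2 = 0) :
    0 < slack Ω D y := by
  have h1 : y.1.itd = 0 := by nlinarith [sq_nonneg y.1.itd, sq_nonneg y.1.itq]
  have h2 : y.1.itq = 0 := by nlinarith [sq_nonneg y.1.itd, sq_nonneg y.1.itq]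
  rw [slack, eta_eq, h1, h2]
  have := D.c_pos
  have := D.Imax_pos
  simp
  positivity

-- Near a state of zero current the slack is positive and the correction vanishes identically;
-- elsewhere it is a product of the Lipschitz function min(η, 0) and a smooth reciprocal.
@[fun_prop]
theorem locallyLipschitz_correction : LocallyLipschitz (correction Ω D) := by
  have hs := locallyLipschitz_slack Ω D
  have hn : ContDiff ℝ 1 fun y : FullState => y.1.itd ^ 2 + y.1.itq ^ 2 := by
    unfold State.itd State.itq
    fun_prop
  refine LocallyLipschitz.of_eventuallyEq fun y => ?_
  by_cases h : y.1.itd ^ 2 + y.1.itq ^ 2 = 0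
  · refine ⟨fun _ => 0, ⟨0, univ, univ_mem, LipschitzWith.lipschitzOnWith (.const _)⟩, ?_⟩
    filter_upwards [hs.continuous.continuousAt.eventually_const_lt
      (slack_pos_of_current_eq_zero Ω D h)] with z hz
    simp [correction, min_eq_right hz.le]
  · refine ⟨_, ?_, EventuallyEq.rfl⟩
    obtain ⟨K, t, ht, hK⟩ := (hn.contDiffAt.inv h).exists_lipschitzOnWith
    obtain ⟨K', t', ht', hK'⟩ := hs.min_const 0 y
    have hmul : LocallyLipschitz fun p : ℝ × ℝ => p.1 * p.2 :=
      ContDiff.locallyLipschitz (𝕂 := ℝ) (by fun_prop)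
    obtain ⟨K'', t'', ht'', hK''⟩ :=
      hmul (min (slack Ω D y) 0, (y.1.itd ^ 2 + y.1.itq ^ 2)⁻¹)
    have hpair : LipschitzOnWith (max K' K)
        (fun z : FullState => (min (slack Ω D z) 0, (z.1.itd ^ 2 + z.1.itq ^ 2)⁻¹)) (t' ∩ t) :=
      (hK'.mono inter_subset_left).prodMk (hK.mono inter_subset_right)
    have hcont : ContinuousAt
        (fun z : FullState => (min (slack Ω D z) 0, (z.1.itd ^ 2 + z.1.itq ^ 2)⁻¹)) y :=
      (hs.min_const 0).continuous.continuousAt.prodMk (hn.continuous.continuousAt.inv₀ h)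
    refine ⟨K'' * max K' K, (t' ∩ t) ∩ _, inter_mem (inter_mem ht' ht) (hcont ht''), ?_⟩
    exact hK''.comp (hpair.mono inter_subset_left) fun z hz => hz.2

/-- Replacing η by min(η, 0) merges both branches of the filter into one formula, to which the
Lipschitz calculus applies. -/
theorem safetyFilter_eq (y : FullState) :
    safetyFilter Ω D y.1 (vtNom Ω D y) =
      vtNom Ω D y + (Ω.Lf / (2 * Ω.ωb) * correction Ω D y) • y.1.it := by
  rw [safetyFilter, correction, it_dotProduct_it]
  change (if 0 ≤ slack Ω D y then _ else _) = _
  split_ifs with h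
  · simp [min_eq_right h]
  · rw [min_eq_left (not_le.1 h).le]; rfl

theorem safetyFilter_of_nonneg {y : FullState} (h : 0 ≤ slack Ω D y) :
    safetyFilter Ω D y.1 (vtNom Ω D y) = vtNom Ω D y :=
  if_pos h

@[fun_prop]
theorem locallyLipschitz_closedLoopField : LocallyLipschitz (closedLoopField Ω D 0 0) := by
  have hd : LocallyLipschitz fun y : FullState => safetyFilter Ω D y.1 (vtNom Ω D y) 0 := by
    simp only [safetyFilter_eq]
    change LocallyLipschitz fun y : FullState =>
      vtdNom Ω D y.1 y.2.1 + Ω.Lf / (2 * Ω.ωb) * correction Ω D y * y.1.itd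
    fun_prop
  have hq : LocallyLipschitz fun y : FullState => safetyFilter Ω D y.1 (vtNom Ω D y) 1 := by
    simp only [safetyFilter_eq]
    change LocallyLipschitz fun y : FullState =>
      vtqNom Ω D y.1 y.2.2 + Ω.Lf / (2 * Ω.ωb) * correction Ω D y * y.1.itq
    fun_prop
  unfold closedLoopField
  refine LocallyLipschitz.prodMk (LocallyLipschitz.euclidean fun i => ?_)
    (LocallyLipschitz.prodMk ?_ ?_)
  · fin_cases i
    on_goal 1 => change LocallyLipschitz fun y : FullState =>
        Ω.ωb * freq D y.1 * y.1.vcq + Ω.ωb / Ω.Cf * (y.1.itd - y.1.igd)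
    on_goal 2 => change LocallyLipschitz fun y : FullState =>
        -Ω.ωb * freq D y.1 * y.1.vcd + Ω.ωb / Ω.Cf * (y.1.itq - y.1.igq)
    on_goal 3 => change LocallyLipschitz fun y : FullState =>
        Ω.ωb * freq D y.1 * y.1.itq +
        Ω.ωb / Ω.Lf * (safetyFilter Ω D y.1 (vtNom Ω D y) 0 - y.1.vcd) -
          Ω.ωb * Ω.Rf / Ω.Lf * y.1.itd
    on_goal 4 => change LocallyLipschitz fun y : FullState =>
        -Ω.ωb * freq D y.1 * y.1.itd +
        Ω.ωb / Ω.Lf * (safetyFilter Ω D y.1 (vtNom Ω D y) 1 - y.1.vcq) -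
          Ω.ωb * Ω.Rf / Ω.Lf * y.1.itq
    on_goal 5 => change LocallyLipschitz fun y : FullState =>
        Ω.ωb * freq D y.1 * y.1.igq + Ω.ωb / Ω.L * (y.1.vcd - 0) - Ω.ωb * Ω.R / Ω.L * y.1.igd
    on_goal 6 => change LocallyLipschitz fun y : FullState =>
        -Ω.ωb * freq D y.1 * y.1.igd + Ω.ωb / Ω.L * (y.1.vcq - 0) - Ω.ωb * Ω.R / Ω.L * y.1.igq
    on_goal 7 => change LocallyLipschitz fun y : FullState =>
        y.1.q₂
    on_goal 8 => change LocallyLipschitz fun y : FullState =>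
        -2 * D.ξq * D.ωqc * y.1.q₂ - D.ωqc ^ 2 * (y.1.q₁ - sat D.Qbar y.1.q)
    on_goal 9 => change LocallyLipschitz fun y : FullState =>
        y.1.p₂
    on_goal 10 => change LocallyLipschitz fun y : FullState =>
        -2 * D.ξp * D.ωpc * y.1.p₂ - D.ωpc ^ 2 * (y.1.p₁ - sat D.Pbar y.1.p)
    all_goals fun_prop
  · fun_prop
  · fun_prop

/-! ### The grid voltage as an additive forcing -/

/-- The direction in which the d-axis grid voltage enters the closed loop. -/
noncomputable def gridDirD : FullState := (EuclideanSpace.single 4 (-(Ω.ωb / Ω.L)), 0, 0)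

/-- The direction in which the q-axis grid voltage enters the closed loop. -/
noncomputable def gridDirQ : FullState := (EuclideanSpace.single 5 (-(Ω.ωb / Ω.L)), 0, 0)

/-- The plant is affine in the grid voltage, so a signal that is only L^∞ can be treated as an
additive forcing of an autonomous locally Lipschitz field. -/
theorem closedLoopField_eq (a b : ℝ) (y : FullState) :
    closedLoopField Ω D a b y =
      closedLoopField Ω D 0 0 y + (a • gridDirD Ω + b • gridDirQ Ω) := by
  refine Prod.ext ?_ (by simp [closedLoopField, gridDirD, gridDirQ])
  ext i
  simp only [closedLoopField, plantField, gridDirD, gridDirQ]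
  fin_cases i <;> simp <;> ring

/-- The grid voltage as a forcing of the closed loop. -/
noncomputable def gridForcing (vgd vgq : ℝ → ℝ) (t : ℝ) : FullState :=
  vgd t • gridDirD Ω + vgq t • gridDirQ Ω

theorem IsBoundedSignal.intervalIntegrable {v : ℝ → ℝ} (hv : IsBoundedSignal v) {T : ℝ}
    (hT : 0 ≤ T) : IntervalIntegrable v volume 0 T := by
  rw [intervalIntegrable_iff_integrableOn_Ioc_of_le hT]
  have h : MemLp v ⊤ (volume.restrict (Ioc 0 T)) :=
    hv.mono_measure (Measure.restrict_mono (fun t ht => ht.1.le) le_rfl)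
  have : IsFiniteMeasure (volume.restrict (Ioc 0 T)) := ⟨by simp⟩
  exact memLp_one_iff_integrable.1 (h.mono_exponent le_top)

theorem IsBoundedSignal.ae_abs_le {v : ℝ → ℝ} (hv : IsBoundedSignal v) :
    ∀ᵐ t, 0 ≤ t → |v t| ≤ supNorm v := by
  have h := ae_le_eLpNormEssSup (f := v) (μ := volume.restrict (Ici (0 : ℝ)))
  rw [ae_restrict_iff' measurableSet_Ici] at h
  filter_upwards [h] with t ht h0
  have h1 := ht h0
  rw [← eLpNorm_exponent_top] at h1
  have h2 := ENNReal.toNNReal_mono hv.2.ne h1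
  have h3 : (‖v t‖ₑ).toNNReal = ‖v t‖₊ := rfl
  rw [h3] at h2
  exact_mod_cast h2

theorem IsBoundedSignal.ae_hasDerivAt_primitive {v : ℝ → ℝ} (hv : IsBoundedSignal v) :
    ∀ᵐ t, 0 ≤ t → HasDerivAt (fun s => ∫ r in (0 : ℝ)..s, v r) (v t) t := by
  have h : ∀ n : ℕ, ∀ᵐ t, t ∈ Icc (0 : ℝ) n →
      HasDerivAt (fun s => ∫ r in (0 : ℝ)..s, v r) (v t) t := fun n => by
    filter_upwards [(hv.intervalIntegrable (T := n) n.cast_nonneg).ae_hasDerivAt_integral]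
      with t ht hmem
    rw [uIcc_of_le n.cast_nonneg] at ht
    exact ht hmem 0 ⟨le_rfl, n.cast_nonneg⟩
  filter_upwards [ae_all_iff.2 h] with t ht h0
  exact ht ⌈t⌉₊ ⟨h0, Nat.le_ceil t⟩

/-- The primitive of the grid forcing. -/
noncomputable def gridPrimitive (vgd vgq : ℝ → ℝ) (t : ℝ) : FullState :=
  (∫ r in (0 : ℝ)..t, vgd r) • gridDirD Ω + (∫ r in (0 : ℝ)..t, vgq r) • gridDirQ Ω

theorem absolutelyContinuous_gridPrimitive {vgd vgq : ℝ → ℝ} (hd : IsBoundedSignal vgd)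
    (hq : IsBoundedSignal vgq) {T : ℝ} (hT : 0 ≤ T) :
    AbsolutelyContinuousOnInterval (gridPrimitive Ω vgd vgq) 0 T := by
  have hsm : ∀ g : FullState, LocallyLipschitz fun c : ℝ => c • g := fun g =>
    ContDiff.locallyLipschitz (𝕂 := ℝ) (by fun_prop)
  have key : ∀ {v : ℝ → ℝ} (g : FullState), IsBoundedSignal v →
      AbsolutelyContinuousOnInterval (fun t => (∫ r in (0 : ℝ)..t, v r) • g) 0 T :=
    fun g hv => by
      have := (hv.intervalIntegrable hT).absolutelyContinuousOnInterval_intervalIntegral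
        (c := 0) (by simp)
      exact this.comp_locallyLipschitz this.continuousOn (g := fun c : ℝ => c • g) (hsm g)
  exact (key (gridDirD Ω) hd).fun_add (key (gridDirQ Ω) hq)

theorem ae_hasDerivAt_gridPrimitive {vgd vgq : ℝ → ℝ} (hd : IsBoundedSignal vgd)
    (hq : IsBoundedSignal vgq) :
    ∀ᵐ t, 0 ≤ t → HasDerivAt (gridPrimitive Ω vgd vgq) (gridForcing Ω vgd vgq t) t := by
  filter_upwards [hd.ae_hasDerivAt_primitive, hq.ae_hasDerivAt_primitive] with t h1 h2 h0
  exact ((h1 h0).smul_const _).add ((h2 h0).smul_const _)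

theorem isSolution_iff {vgd vgq : ℝ → ℝ} {y : ℝ → FullState} :
    IsSolution Ω D vgd vgq y ↔
      ∀ T, 0 ≤ T → IsForcedSolutionOn (closedLoopField Ω D 0 0) (gridForcing Ω vgd vgq) T y := by
  have e : ∀ t, closedLoopField Ω D (vgd t) (vgq t) (y t) =
      closedLoopField Ω D 0 0 (y t) + gridForcing Ω vgd vgq t := fun t =>
    closedLoopField_eq Ω D _ _ _
  constructor
  · intro h T hT
    have h1 := h.ode
    rw [ae_restrict_iff' measurableSet_Ici] at h1
    simp only [e] at h1
    refine ⟨h.absCont T hT, ?_⟩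
    filter_upwards [h1] with t ht hmem using ht hmem.1
  · intro h
    refine ⟨fun T hT => (h T hT).absCont, ?_⟩
    rw [ae_restrict_iff' measurableSet_Ici]
    simp only [e]
    -- Countably many null sets, one for each [0, n], cover the exceptional times of the half-line.
    filter_upwards [ae_all_iff.2 fun n : ℕ => (h n n.cast_nonneg).ode] with t ht h0
    exact ht ⌈t⌉₊ ⟨h0, Nat.le_ceil t⟩

end GFM

theorem IsForcedSolutionOn.absolutelyContinuous_comp {E X : Type*} [NormedAddCommGroup E]
    [NormedSpace ℝ E] [PseudoMetricSpace X] {F : E → E} {u : ℝ → E} {T : ℝ} {y : ℝ → E}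
    (h : IsForcedSolutionOn F u T y) {g : E → X} (hg : LocallyLipschitz g) :
    AbsolutelyContinuousOnInterval (fun t => g (y t)) 0 T :=
  h.absCont.comp_locallyLipschitz h.absCont.uniformContinuousOn.continuousOn hg

namespace GFM

/-! ### Derivatives of the physical states along a solution -/

theorem hasDerivAt_coord {y : ℝ → FullState} {Y : FullState} {t : ℝ} (h : HasDerivAt y Y t)
    (i : Fin 10) : HasDerivAt (fun s => (y s).1 i) (Y.1 i) t :=
  ((EuclideanSpace.proj i : State →L[ℝ] ℝ).comp
    (ContinuousLinearMap.fst ℝ State (ℝ × ℝ))).hasFDerivAt.comp_hasDerivAt t h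

/-- The derivatives of the components of a closed-loop trajectory at a time `t` where the
differential equation holds with terminal voltage `(v₀, v₁)` and grid voltage `(a, b)`. -/
structure DerivData (Ω : Circuit) (D : Design) (a b v₀ v₁ : ℝ) (y : ℝ → FullState) (t : ℝ) :
    Prop where
  vcd : HasDerivAt (fun s => (y s).1.vcd) (Ω.ωb * freq D (y t).1 * (y t).1.vcq
    + Ω.ωb / Ω.Cf * ((y t).1.itd - (y t).1.igd)) t
  vcq : HasDerivAt (fun s => (y s).1.vcq) (-Ω.ωb * freq D (y t).1 * (y t).1.vcd
    + Ω.ωb / Ω.Cf * ((y t).1.itq - (y t).1.igq)) t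
  itd : HasDerivAt (fun s => (y s).1.itd) (Ω.ωb * freq D (y t).1 * (y t).1.itq
    + Ω.ωb / Ω.Lf * (v₀ - (y t).1.vcd) - Ω.ωb * Ω.Rf / Ω.Lf * (y t).1.itd) t
  itq : HasDerivAt (fun s => (y s).1.itq) (-Ω.ωb * freq D (y t).1 * (y t).1.itd
    + Ω.ωb / Ω.Lf * (v₁ - (y t).1.vcq) - Ω.ωb * Ω.Rf / Ω.Lf * (y t).1.itq) t
  igd : HasDerivAt (fun s => (y s).1.igd) (Ω.ωb * freq D (y t).1 * (y t).1.igq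
    + Ω.ωb / Ω.L * ((y t).1.vcd - a) - Ω.ωb * Ω.R / Ω.L * (y t).1.igd) t
  igq : HasDerivAt (fun s => (y s).1.igq) (-Ω.ωb * freq D (y t).1 * (y t).1.igd
    + Ω.ωb / Ω.L * ((y t).1.vcq - b) - Ω.ωb * Ω.R / Ω.L * (y t).1.igq) t
  q₁ : HasDerivAt (fun s => (y s).1.q₁) (y t).1.q₂ t
  q₂ : HasDerivAt (fun s => (y s).1.q₂) (-2 * D.ξq * D.ωqc * (y t).1.q₂
    - D.ωqc ^ 2 * ((y t).1.q₁ - sat D.Qbar (y t).1.q)) t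
  p₁ : HasDerivAt (fun s => (y s).1.p₁) (y t).1.p₂ t
  p₂ : HasDerivAt (fun s => (y s).1.p₂) (-2 * D.ξp * D.ωpc * (y t).1.p₂
    - D.ωpc ^ 2 * ((y t).1.p₁ - sat D.Pbar (y t).1.p)) t
  zd : HasDerivAt (fun s => (y s).2.1)
    (D.Γd * Real.exp (-(y t).2.1) * max (Wd Ω D (y t).1 - D.ε) 0) t
  zq : HasDerivAt (fun s => (y s).2.2)
    (D.Γq * Real.exp (-(y t).2.2) * max (Wq Ω D (y t).1 - D.ε) 0) t

variable {Ω : Circuit} {D : Design} {vgd vgq : ℝ → ℝ} {T : ℝ} {y : ℝ → FullState}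

theorem DerivData.of_hasDerivAt {a b t : ℝ}
    (h : HasDerivAt y (closedLoopField Ω D a b (y t)) t) :
    DerivData Ω D a b (safetyFilter Ω D (y t).1 (vtNom Ω D (y t)) 0)
      (safetyFilter Ω D (y t).1 (vtNom Ω D (y t)) 1) y t where
  vcd := hasDerivAt_coord h 0
  vcq := hasDerivAt_coord h 1
  itd := hasDerivAt_coord h 2
  itq := hasDerivAt_coord h 3
  igd := hasDerivAt_coord h 4
  igq := hasDerivAt_coord h 5
  q₁ := hasDerivAt_coord h 6
  q₂ := hasDerivAt_coord h 7
  p₁ := hasDerivAt_coord h 8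
  p₂ := hasDerivAt_coord h 9
  zd := ((ContinuousLinearMap.fst ℝ ℝ ℝ).comp
    (ContinuousLinearMap.snd ℝ State (ℝ × ℝ))).hasFDerivAt.comp_hasDerivAt t h
  zq := ((ContinuousLinearMap.snd ℝ ℝ ℝ).comp
    (ContinuousLinearMap.snd ℝ State (ℝ × ℝ))).hasFDerivAt.comp_hasDerivAt t h

/-- `y` solves the closed loop on `[0, T]`. -/
abbrev IsSolutionUpTo (Ω : Circuit) (D : Design) (vgd vgq : ℝ → ℝ) (T : ℝ)
    (y : ℝ → FullState) : Prop :=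
  IsForcedSolutionOn (closedLoopField Ω D 0 0) (gridForcing Ω vgd vgq) T y

theorem ae_derivData (hy : IsSolutionUpTo Ω D vgd vgq T y) :
    ∀ᵐ t, t ∈ Icc 0 T → DerivData Ω D (vgd t) (vgq t)
      (safetyFilter Ω D (y t).1 (vtNom Ω D (y t)) 0)
      (safetyFilter Ω D (y t).1 (vtNom Ω D (y t)) 1) y t := by
  filter_upwards [hy.ode] with t ht hmem
  refine DerivData.of_hasDerivAt ?_
  rw [closedLoopField_eq]
  exact ht hmem

/-! ### Safety -/

theorem correction_mul_current (z : FullState) :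
    correction Ω D z * (z.1.itd ^ 2 + z.1.itq ^ 2) = min (slack Ω D z) 0 := by
  by_cases h : z.1.itd ^ 2 + z.1.itq ^ 2 = 0
  · rw [h, mul_zero, min_eq_right (slack_pos_of_current_eq_zero Ω D h).le]
  · rw [correction, div_mul_cancel₀ _ h]

/-- With s = ‖i_t‖², the filtered dynamics give s' ≤ c(I_max² - s), and the Grönwall bound is
max(s(0), I_max²). The nominal voltage enters only through η and disappears. -/
theorem current_sq_le (hT : 0 ≤ T) (hy : IsSolutionUpTo Ω D vgd vgq T y)
    (h0 : (y 0).1 ∈ safeSet D) : (y T).1.itd ^ 2 + (y T).1.itq ^ 2 ≤ D.Imax ^ 2 := by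
  have hac := hy.absolutelyContinuous_comp
    (g := fun z : FullState => z.1.itd ^ 2 + z.1.itq ^ 2) (by fun_prop)
  have h := hac.le_max_of_ae_deriv_le hT D.c_pos (C := D.c * D.Imax ^ 2) (by
    filter_upwards [ae_derivData hy] with t ht hmem
    have h := ht hmem
    refine ⟨_, (h.itd.pow 2).add (h.itq.pow 2), ?_⟩
    have hΩ := Ω.ωb_pos.ne'
    have hL := Ω.Lf_pos.ne'
    have hs : slack Ω D (y t) = _ := eta_eq Ω D (y t).1 (vtNom Ω D (y t))
    have hc := correction_mul_current (Ω := Ω) (D := D) (y t)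
    have hmin : min (slack Ω D (y t)) 0 ≤ slack Ω D (y t) := min_le_left _ _
    simp only [safetyFilter_eq, Pi.add_apply, Pi.smul_apply, smul_eq_mul, State.it,
      Matrix.cons_val_zero, Matrix.cons_val_one]
    set x := (y t).1
    set κ := correction Ω D (y t)
    set v := vtNom Ω D (y t)
    have key : 2 * x.itd * (Ω.ωb * freq D x * x.itq
          + Ω.ωb / Ω.Lf * (v 0 + Ω.Lf / (2 * Ω.ωb) * κ * x.itd - x.vcd)
          - Ω.ωb * Ω.Rf / Ω.Lf * x.itd)
        + 2 * x.itq * (-Ω.ωb * freq D x * x.itd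
          + Ω.ωb / Ω.Lf * (v 1 + Ω.Lf / (2 * Ω.ωb) * κ * x.itq - x.vcq)
          - Ω.ωb * Ω.Rf / Ω.Lf * x.itq)
        = D.c * (D.Imax ^ 2 - (x.itd ^ 2 + x.itq ^ 2))
          - slack Ω D (y t) + κ * (x.itd ^ 2 + x.itq ^ 2) := by
      rw [hs]
      field_simp
      ring
    norm_num
    linarith)
  refine h.trans (max_le h0 ?_)
  rw [mul_div_cancel_left₀ _ D.c_pos.ne']

/-! ### The grid-side energy -/

/-- Along one axis, the storage function `(C v² + L i²)/2 - δ v i` of the capacitor and grid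
inductor is positive definite and strictly dissipative. -/
theorem exists_storage (Ω : Circuit) : ∃ δ κ C k : ℝ, 0 < κ ∧ 0 ≤ C ∧ 0 < k ∧
    ∀ v i τ g : ℝ,
      k * (v ^ 2 + i ^ 2) ≤ (Ω.Cf * v ^ 2 + Ω.L * i ^ 2) / 2 - δ * (v * i) ∧
      Ω.Cf * v * (Ω.ωb / Ω.Cf * (τ - i)) + Ω.L * i * (Ω.ωb / Ω.L * (v - g) - Ω.ωb * Ω.R / Ω.L * i)
        - δ * (Ω.ωb / Ω.Cf * (τ - i) * i + v * (Ω.ωb / Ω.L * (v - g) - Ω.ωb * Ω.R / Ω.L * i))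
      ≤ -κ * ((Ω.Cf * v ^ 2 + Ω.L * i ^ 2) / 2 - δ * (v * i)) + C * (τ ^ 2 + g ^ 2) := by
  obtain ⟨w, a, _, _, l, r, hw, ha, _, _, hl, hr⟩ := Ω
  simp only
  -- The first entry keeps the cross term below half of the energy; the second makes the i² terms
  -- that it generates absorbable by a quarter of the resistive loss.
  set δ := min (min a l / 2) (r / 4 / (1 / a + r ^ 2 / l)) with hδ
  have hden : 0 < 1 / a + r ^ 2 / l := by positivity
  have hδpos : 0 < δ := lt_min (by positivity) (by positivity)
  have hδa : δ ≤ a / 2 := (min_le_left _ _).trans (by linarith [min_le_left a l])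
  have hδl : δ ≤ l / 2 := (min_le_left _ _).trans (by linarith [min_le_right a l])
  have hδr : δ / a + δ * r ^ 2 / l ≤ r / 4 := by
    have : δ ≤ r / 4 / (1 / a + r ^ 2 / l) := min_le_right _ _
    rw [le_div_iff₀ hden] at this
    calc δ / a + δ * r ^ 2 / l = δ * (1 / a + r ^ 2 / l) := by ring
      _ ≤ r / 4 := this
  have hcross : ∀ v i : ℝ, |δ * (v * i)| ≤ (a * v ^ 2 + l * i ^ 2) / 4 := fun v i => by
    have h1 : |δ * (v * i)| = δ * (|v| * |i|) := by rw [abs_mul, abs_mul, abs_of_pos hδpos]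
    rw [h1, ← sq_abs v, ← sq_abs i]
    have hv := abs_nonneg v
    have hi := abs_nonneg i
    nlinarith [sq_nonneg (|v| - |i|), mul_nonneg (sub_nonneg.2 hδa) (sq_nonneg |v|),
      mul_nonneg (sub_nonneg.2 hδl) (sq_nonneg |i|)]
  set κ := min (δ / (2 * l * a)) (r / (2 * l)) with hκ
  have hκpos : 0 < κ := lt_min (by positivity) (by positivity)
  set c₁ := 2 * l / δ + 2 * δ ^ 2 / (r * a ^ 2) with hc₁
  set c₂ := 2 * δ / l + 2 / r with hc₂
  have hc₁pos : 0 < c₁ := by positivity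
  have hc₂pos : 0 < c₂ := by positivity
  refine ⟨δ, w * κ, w * (c₁ + c₂), min a l / 4, by positivity, by positivity, by positivity,
    fun v i τ g => ⟨?_, ?_⟩⟩
  · have := (abs_le.1 (hcross v i)).2
    nlinarith [mul_le_mul_of_nonneg_right (min_le_left a l) (sq_nonneg v),
      mul_le_mul_of_nonneg_right (min_le_right a l) (sq_nonneg i)]
  · have hE : κ * ((a * v ^ 2 + l * i ^ 2) / 2 - δ * (v * i)) ≤
        δ / (2 * l) * v ^ 2 + r / 2 * i ^ 2 := by
      have h1 : (a * v ^ 2 + l * i ^ 2) / 2 - δ * (v * i) ≤ a * v ^ 2 + l * i ^ 2 := by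
        have := (abs_le.1 (hcross v i)).1
        have : 0 ≤ a * v ^ 2 + l * i ^ 2 := by positivity
        linarith
      calc _ ≤ κ * (a * v ^ 2 + l * i ^ 2) := by gcongr
        _ = κ * (a * v ^ 2) + κ * (l * i ^ 2) := by ring
        _ ≤ δ / (2 * l * a) * (a * v ^ 2) + r / (2 * l) * (l * i ^ 2) := by
          gcongr
          · exact min_le_left _ _
          · exact min_le_right _ _
        _ = _ := by field_simp
    have hX : v * τ - i * g - r * i ^ 2 - δ / a * (τ * i) + δ / a * i ^ 2 - δ / l * v ^ 2
        + δ / l * (v * g) + δ * r / l * (v * i) ≤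
        -(δ / (2 * l) * v ^ 2 + r / 2 * i ^ 2) + c₁ * τ ^ 2 + c₂ * g ^ 2 := by
      -- Half of each dissipation, δ/l·v² and r·i², is kept. The other half pays for the cross terms
      -- by completed squares, in shares 1/8 + 1/8 + 1/4; the last quarter of r·i² is spent through
      -- `hδr`.
      have s1 : 0 ≤ δ / (8 * l) * (v - 4 * l / δ * τ) ^ 2 := by positivity
      have s2 : 0 ≤ δ / (8 * l) * (v - 4 * g) ^ 2 := by positivity
      have s3 : 0 ≤ δ / (4 * l) * (v - 2 * r * i) ^ 2 := by positivity
      have s4 : 0 ≤ r / 8 * (i + 4 * g / r) ^ 2 := by positivity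
      have s5 : 0 ≤ r / 8 * (i + 4 * δ / (r * a) * τ) ^ 2 := by positivity
      have s6 := mul_le_mul_of_nonneg_right hδr (sq_nonneg i)
      have : -(δ / (2 * l) * v ^ 2 + r / 2 * i ^ 2) + c₁ * τ ^ 2 + c₂ * g ^ 2
          - (v * τ - i * g - r * i ^ 2 - δ / a * (τ * i) + δ / a * i ^ 2 - δ / l * v ^ 2
            + δ / l * (v * g) + δ * r / l * (v * i))
          = δ / (8 * l) * (v - 4 * l / δ * τ) ^ 2 + δ / (8 * l) * (v - 4 * g) ^ 2
            + δ / (4 * l) * (v - 2 * r * i) ^ 2 + r / 8 * (i + 4 * g / r) ^ 2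
            + r / 8 * (i + 4 * δ / (r * a) * τ) ^ 2
            + (r / 4 * i ^ 2 - (δ / a + δ * r ^ 2 / l) * i ^ 2) := by
        rw [hc₁, hc₂]
        field_simp
        ring
      linarith
    have hlhs : a * v * (w / a * (τ - i)) + l * i * (w / l * (v - g) - w * r / l * i)
        - δ * (w / a * (τ - i) * i + v * (w / l * (v - g) - w * r / l * i))
        = w * (v * τ - i * g - r * i ^ 2 - δ / a * (τ * i) + δ / a * i ^ 2 - δ / l * v ^ 2
        + δ / l * (v * g) + δ * r / l * (v * i)) := by
      field_simp
      ring
    rw [hlhs]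
    have h3 : c₁ * τ ^ 2 + c₂ * g ^ 2 ≤ (c₁ + c₂) * (τ ^ 2 + g ^ 2) := by
      nlinarith [mul_nonneg hc₁pos.le (sq_nonneg g), mul_nonneg hc₂pos.le (sq_nonneg τ)]
    calc _ ≤ w * (-(κ * ((a * v ^ 2 + l * i ^ 2) / 2 - δ * (v * i)))
          + (c₁ + c₂) * (τ ^ 2 + g ^ 2)) := mul_le_mul_of_nonneg_left (by linarith) hw.le
      _ = _ := by ring

/-- The sum of the storage functions of both axes is invariant under simultaneous rotation of
voltage and current, so the terms with the still uncontrolled frequency cancel. Safety bounds the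
input current. -/
theorem exists_grid_bound (Ω : Circuit) (D : Design) :
    ∃ B : State × ℝ≥0 × ℝ≥0 → ℝ≥0, Continuous B ∧
      ∀ vgd vgq : ℝ → ℝ, IsBoundedSignal vgd → IsBoundedSignal vgq → ∀ T, 0 ≤ T → ∀ y,
        IsSolutionUpTo Ω D vgd vgq T y → (y 0).1 ∈ safeSet D →
        (y T).1.vcd ^ 2 + (y T).1.vcq ^ 2 + (y T).1.igd ^ 2 + (y T).1.igq ^ 2
          ≤ B ((y 0).1, supNorm vgd, supNorm vgq) := by
  obtain ⟨δ, κ, C, k, hκ, hC, hk, hst⟩ := exists_storage Ω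
  set E : State → ℝ := fun x => ((Ω.Cf * x.vcd ^ 2 + Ω.L * x.igd ^ 2) / 2 - δ * (x.vcd * x.igd))
    + ((Ω.Cf * x.vcq ^ 2 + Ω.L * x.igq ^ 2) / 2 - δ * (x.vcq * x.igq)) with hE
  have lE : LocallyLipschitz E := by fun_prop
  have cE : Continuous E := lE.continuous
  refine ⟨fun p => ((max (E p.1)
    (C * (D.Imax ^ 2 + (p.2.1 : ℝ) ^ 2 + (p.2.2 : ℝ) ^ 2) / κ)) / k).toNNReal,
    by fun_prop, ?_⟩
  intro vgd vgq hd hq T hT y hy h0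
  refine le_trans ?_ (Real.le_coe_toNNReal _)
  rw [le_div_iff₀ hk]
  have hEk : ((y T).1.vcd ^ 2 + (y T).1.vcq ^ 2 + (y T).1.igd ^ 2 + (y T).1.igq ^ 2) * k
      ≤ E (y T).1 := by
    have h1 := (hst (y T).1.vcd (y T).1.igd 0 0).1
    have h2 := (hst (y T).1.vcq (y T).1.igq 0 0).1
    simp only [hE]
    linarith
  refine hEk.trans ?_
  have hac := hy.absolutelyContinuous_comp (g := fun z : FullState => E z.1) (by fun_prop)
  refine hac.le_max_of_ae_deriv_le hT hκ ?_
  filter_upwards [ae_derivData hy, hd.ae_abs_le, hq.ae_abs_le] with t ht hdt hqt hmem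
  have h := ht hmem
  have ha := hdt hmem.1
  have hb := hqt hmem.1
  have hI := current_sq_le hmem.1 (hy.mono hmem.1 hmem.2) h0
  have hder := ((((h.vcd.pow 2).const_mul Ω.Cf).add ((h.igd.pow 2).const_mul Ω.L)).div_const 2).sub
      ((h.vcd.mul h.igd).const_mul δ) |>.add
    (((((h.vcq.pow 2).const_mul Ω.Cf).add ((h.igq.pow 2).const_mul Ω.L)).div_const 2).sub
      ((h.vcq.mul h.igq).const_mul δ))
  refine ⟨_, hder, ?_⟩
  have h1 := (hst (y t).1.vcd (y t).1.igd (y t).1.itd (vgd t)).2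
  have h2 := (hst (y t).1.vcq (y t).1.igq (y t).1.itq (vgq t)).2
  have ha2 : vgd t ^ 2 ≤ (supNorm vgd : ℝ) ^ 2 := sq_le_sq' (by linarith [(abs_le.1 ha).1])
    (abs_le.1 ha).2
  have hb2 : vgq t ^ 2 ≤ (supNorm vgq : ℝ) ^ 2 := sq_le_sq' (by linarith [(abs_le.1 hb).1])
    (abs_le.1 hb).2
  have h3 : C * (((y t).1.itd ^ 2 + (y t).1.itq ^ 2) + vgd t ^ 2 + vgq t ^ 2) ≤
      C * (D.Imax ^ 2 + (supNorm vgd : ℝ) ^ 2 + (supNorm vgq : ℝ) ^ 2) := by gcongr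
  simp only [hE]
  norm_num
  linarith

/-! ### The power filters -/

/-- An overdamped second-order filter with bounded input has a bounded state. -/
theorem exists_filter_bound {ω ξ : ℝ} (hω : 0 < ω) (hξ : 1 < ξ) :
    ∃ G : ℝ, 0 ≤ G ∧ ∀ (T S : ℝ) (f₁ f₂ s : ℝ → ℝ), 0 ≤ T → 0 ≤ S →
      (∀ t, 0 ≤ t → t ≤ T → AbsolutelyContinuousOnInterval f₁ 0 t) →
      (∀ t, 0 ≤ t → t ≤ T → AbsolutelyContinuousOnInterval f₂ 0 t) →
      (∀ᵐ t, t ∈ Icc 0 T → HasDerivAt f₁ (f₂ t) t) →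
      (∀ᵐ t, t ∈ Icc 0 T → HasDerivAt f₂ (-2 * ξ * ω * f₂ t - ω ^ 2 * (f₁ t - s t)) t) →
      (∀ t ∈ Icc 0 T, |s t| ≤ S) → |f₁ T| + |f₂ T| ≤ G * (|f₁ 0| + |f₂ 0| + S) := by
  have hr : 0 < ξ ^ 2 - 1 := by nlinarith
  set ρ := √(ξ ^ 2 - 1) with hρ
  have hρ0 : 0 < ρ := Real.sqrt_pos.2 hr
  have hρ2 : ρ ^ 2 = ξ ^ 2 - 1 := Real.sq_sqrt hr.le
  have hρξ : ρ < ξ := by nlinarith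
  -- -a and -b are the characteristic roots, real and negative since ξ > 1. Then r = f₂ + a f₁
  -- satisfies r' = -b r + ω² s, and f₁' = -a f₁ + r: two scalar first-order estimates.
  set a := ω * (ξ - ρ) with ha
  set b := ω * (ξ + ρ) with hb
  have ha0 : 0 < a := mul_pos hω (by linarith)
  have hb0 : 0 < b := mul_pos hω (by linarith)
  have hab : a * b = ω ^ 2 := by
    rw [ha, hb]; linear_combination (-ω ^ 2) * hρ2
  have hsum : a + b = 2 * ξ * ω := by rw [ha, hb]; ring
  refine ⟨(1 + a) + (2 + 1 / a) * (1 + a + ω ^ 2 / b), by positivity, ?_⟩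
  intro T S f₁ f₂ s hT hS ac₁ ac₂ d₁ d₂ hs
  set M := |f₂ 0| + a * |f₁ 0| + ω ^ 2 / b * S with hM
  have hr : ∀ t ∈ Icc 0 T, |f₂ t + a * f₁ t| ≤ M := by
    intro t ht
    have h := ((ac₂ t ht.1 ht.2).fun_add
      ((ac₁ t ht.1 ht.2).const_mul a)).abs_le_max_of_ae_hasDerivAt
      (s := fun t => ω ^ 2 * s t) (C := ω ^ 2 * S) ht.1 hb0 (by
        filter_upwards [d₁, d₂] with r h₁ h₂ hmem
        have hmem' : r ∈ Icc 0 T := ⟨hmem.1, hmem.2.trans ht.2⟩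
        convert! (h₂ hmem').add ((h₁ hmem').const_mul a) using 1
        linear_combination (-f₂ r) * hsum - f₁ r * hab) (fun r hmem => by
        rw [abs_mul, abs_of_pos (by positivity : 0 < ω ^ 2)]
        gcongr
        exact hs r ⟨hmem.1, hmem.2.trans ht.2⟩)
    refine h.trans (max_le ?_ ?_)
    · calc |f₂ 0 + a * f₁ 0| ≤ |f₂ 0| + |a * f₁ 0| := abs_add_le _ _
        _ = |f₂ 0| + a * |f₁ 0| := by rw [abs_mul, abs_of_pos ha0]
        _ ≤ M := by rw [hM]; linarith [show 0 ≤ ω ^ 2 / b * S by positivity]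
    · calc ω ^ 2 * S / b = ω ^ 2 / b * S := by ring
        _ ≤ M := by
          rw [hM]
          linarith [abs_nonneg (f₂ 0), mul_nonneg ha0.le (abs_nonneg (f₁ 0))]
  have h₁ : |f₁ T| ≤ |f₁ 0| + M / a := by
    have h := (ac₁ T hT le_rfl).abs_le_max_of_ae_hasDerivAt
      (s := fun t => f₂ t + a * f₁ t) hT ha0 (by
        filter_upwards [d₁] with r h₁ hmem
        convert! h₁ hmem using 1
        ring) hr
    have hM0 : 0 ≤ M := by positivity
    exact h.trans (max_le (by linarith [show 0 ≤ M / a by positivity])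
      (by linarith [abs_nonneg (f₁ 0)]))
  have h₂ : |f₂ T| ≤ M + a * |f₁ T| := by
    have h3 : |f₂ T| ≤ |f₂ T + a * f₁ T| + |a * f₁ T| := by
      have := abs_sub (f₂ T + a * f₁ T) (a * f₁ T)
      rwa [add_sub_cancel_right] at this
    rw [abs_mul, abs_of_pos ha0] at h3
    linarith [hr T ⟨hT, le_rfl⟩]
  have h4 : |f₁ T| + |f₂ T| ≤ (1 + a) * |f₁ 0| + (2 + 1 / a) * M := by
    have : (1 + a) * |f₁ T| ≤ (1 + a) * (|f₁ 0| + M / a) := by gcongr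
    have e : (1 + a) * (|f₁ 0| + M / a) = (1 + a) * |f₁ 0| + (1 + 1 / a) * M := by
      field_simp
      ring
    linarith
  have h5 : M ≤ (1 + a + ω ^ 2 / b) * (|f₁ 0| + |f₂ 0| + S) := by
    rw [hM]
    have := abs_nonneg (f₁ 0)
    have := abs_nonneg (f₂ 0)
    have : 0 ≤ ω ^ 2 / b := by positivity
    nlinarith [mul_nonneg ha0.le (abs_nonneg (f₂ 0)), mul_nonneg ha0.le hS,
      mul_nonneg this (abs_nonneg (f₁ 0)), mul_nonneg this (abs_nonneg (f₂ 0))]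
  have h6 : (2 + 1 / a) * M ≤ (2 + 1 / a) * ((1 + a + ω ^ 2 / b) * (|f₁ 0| + |f₂ 0| + S)) := by
    gcongr
  have h7 : (1 + a) * |f₁ 0| ≤ (1 + a) * (|f₁ 0| + |f₂ 0| + S) := by
    gcongr
    linarith [abs_nonneg (f₂ 0)]
  linarith

/-! ### A priori bounds for the physical states -/

theorem norm_rest_sq (x : State) : ‖x.rest‖ ^ 2 = (x.vcd ^ 2 + x.vcq ^ 2 + x.igd ^ 2 + x.igq ^ 2)
    + (x.q₁ ^ 2 + x.q₂ ^ 2) + (x.p₁ ^ 2 + x.p₂ ^ 2) := by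
  rw [EuclideanSpace.norm_sq_eq, Fin.sum_univ_eight]
  simp [State.rest]
  ring

/-- Both |p| and |q| are at most the sum of squares bounded by `exists_grid_bound`; saturation only
decreases them, and the filter estimate finishes. -/
theorem exists_rest_bound (Ω : Circuit) (D : Design) :
    ∃ B : State × ℝ≥0 × ℝ≥0 → ℝ≥0, Continuous B ∧
      ∀ vgd vgq : ℝ → ℝ, IsBoundedSignal vgd → IsBoundedSignal vgq → ∀ T, 0 ≤ T → ∀ y,
        IsSolutionUpTo Ω D vgd vgq T y → (y 0).1 ∈ safeSet D →
        ‖(y T).1.rest‖ ≤ B ((y 0).1, supNorm vgd, supNorm vgq) := by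
  obtain ⟨B, hB, hbound⟩ := exists_grid_bound Ω D
  obtain ⟨Gq, hGq, hq⟩ := exists_filter_bound D.ωqc_pos D.one_lt_ξq
  obtain ⟨Gp, hGp, hp⟩ := exists_filter_bound D.ωpc_pos D.one_lt_ξp
  have c1 := locallyLipschitz_q₁.continuous
  have c2 := locallyLipschitz_q₂.continuous
  have c3 := locallyLipschitz_p₁.continuous
  have c4 := locallyLipschitz_p₂.continuous
  refine ⟨fun p => (√(B p + (Gq * (|p.1.q₁| + |p.1.q₂| + B p)) ^ 2
    + (Gp * (|p.1.p₁| + |p.1.p₂| + B p)) ^ 2)).toNNReal, by fun_prop, ?_⟩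
  intro vgd vgq hd hqs T hT y hy h0
  refine le_trans ?_ (Real.le_coe_toNNReal _)
  refine Real.le_sqrt_of_sq_le ?_
  set β : ℝ := ((B ((y 0).1, supNorm vgd, supNorm vgq) : ℝ≥0) : ℝ) with hβ
  have hgrid : ∀ t ∈ Icc 0 T,
      (y t).1.vcd ^ 2 + (y t).1.vcq ^ 2 + (y t).1.igd ^ 2 + (y t).1.igq ^ 2 ≤ β := fun t ht =>
    hbound vgd vgq hd hqs t ht.1 y (hy.mono ht.1 ht.2) h0
  have hac : ∀ {g : State → ℝ}, LocallyLipschitz g → ∀ t, 0 ≤ t → t ≤ T →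
      AbsolutelyContinuousOnInterval (fun s => g (y s).1) 0 t := fun {g} hg t h0 hT =>
    (hy.mono h0 hT).absolutelyContinuous_comp (g := fun z : FullState => g z.1)
      (hg.comp LipschitzWith.prod_fst.locallyLipschitz)
  have hQ := hq T β _ _ (fun t => sat D.Qbar (y t).1.q) hT (NNReal.coe_nonneg _)
    (hac locallyLipschitz_q₁) (hac locallyLipschitz_q₂)
    (by filter_upwards [ae_derivData hy] with t ht hmem using (ht hmem).q₁)
    (by filter_upwards [ae_derivData hy] with t ht hmem using (ht hmem).q₂)
    (fun t ht => by
      refine (abs_sat_le _ D.Qbar_pos _).trans ((abs_le.2 ⟨?_, ?_⟩).trans (hgrid t ht)) <;>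
      · rw [State.q]
        nlinarith [sq_nonneg ((y t).1.vcq - (y t).1.igd), sq_nonneg ((y t).1.vcd - (y t).1.igq),
          sq_nonneg ((y t).1.vcq + (y t).1.igd), sq_nonneg ((y t).1.vcd + (y t).1.igq)])
  have hP := hp T β _ _ (fun t => sat D.Pbar (y t).1.p) hT (NNReal.coe_nonneg _)
    (hac locallyLipschitz_p₁) (hac locallyLipschitz_p₂)
    (by filter_upwards [ae_derivData hy] with t ht hmem using (ht hmem).p₁)
    (by filter_upwards [ae_derivData hy] with t ht hmem using (ht hmem).p₂)
    (fun t ht => by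
      refine (abs_sat_le _ D.Pbar_pos _).trans ((abs_le.2 ⟨?_, ?_⟩).trans (hgrid t ht)) <;>
      · rw [State.p]
        nlinarith [sq_nonneg ((y t).1.vcd - (y t).1.igd), sq_nonneg ((y t).1.vcq - (y t).1.igq),
          sq_nonneg ((y t).1.vcd + (y t).1.igd), sq_nonneg ((y t).1.vcq + (y t).1.igq)])
  have hsq : ∀ u v w : ℝ, |u| + |v| ≤ w → u ^ 2 + v ^ 2 ≤ w ^ 2 := fun u v w h => by
    rw [← sq_abs u, ← sq_abs v]
    nlinarith [abs_nonneg u, abs_nonneg v]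
  rw [norm_rest_sq]
  exact add_le_add (add_le_add (hgrid T ⟨hT, le_rfl⟩) (hsq _ _ _ hQ)) (hsq _ _ _ hP)

end GFM

namespace GFM

/-! ### Nominal tracking dynamics -/

section Tracking

variable {Ω : Circuit} {D : Design} {y : ℝ → FullState} {a b v₀ v₁ t : ℝ}

theorem DerivData.freq (h : DerivData Ω D a b v₀ v₁ y t) :
    HasDerivAt (fun s => GFM.freq D (y s).1) (-(D.KP * (y t).1.p₂)) t := by
  convert! ((h.p₁.const_sub D.P₀).const_mul D.KP).const_add D.ω₀ using 1
  ring

/-- First backstepping stage: the current reference is what turns the voltage error into a damped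
equation driven by the current error. It holds for any terminal voltage. -/
theorem DerivData.voltageError (h : DerivData Ω D a b v₀ v₁ y t) :
    HasDerivAt (fun s => (y s).1.vcd - vcdRef D (y s).1)
      (-D.KVC * ((y t).1.vcd - vcdRef D (y t).1)
        + Ω.ωb / Ω.Cf * ((y t).1.itd - itdRef Ω D (y t).1)) t := by
  convert! h.vcd.sub (((h.q₁.const_sub D.Q₀).const_mul D.KQ).const_add D.V₀) using 1
  have := Ω.ωb_pos.ne'
  have := Ω.Cf_pos.ne'
  unfold itdRef
  field_simp
  ring

/-- Second stage: the nominal voltage cancels every term of the error dynamics except the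
non-rotational part of the grid-current derivative, which contains the unmeasured grid voltage. That
part is left to the damping in `ud`. -/
theorem DerivData.currentErrorD (h : DerivData Ω D a b (vtdNom Ω D (y t).1 (y t).2.1) v₁ y t) :
    HasDerivAt (fun s => (y s).1.itd - itdRef Ω D (y s).1)
      (ud Ω D (y t).1 (y t).2.1
        - (Ω.ωb / Ω.L * ((y t).1.vcd - a) - Ω.ωb * Ω.R / Ω.L * (y t).1.igd)) t := by
  convert! h.itd.sub (((h.igd.sub ((h.freq.const_mul Ω.Cf).mul h.vcq)).sub
    (h.q₂.const_mul (Ω.Cf * D.KQ / Ω.ωb))).sub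
    (h.voltageError.const_mul (Ω.Cf * D.KVC / Ω.ωb))) using 1
  have := Ω.ωb_pos.ne'
  have := Ω.Cf_pos.ne'
  have := Ω.Lf_pos.ne'
  have := Ω.L_pos.ne'
  unfold vtdNom
  generalize itdRef Ω D (y t).1 = ref
  generalize ud Ω D (y t).1 (y t).2.1 = u
  generalize vcdRef D (y t).1 = vref
  generalize sat D.Qbar (y t).1.q = sq
  field_simp
  ring

theorem DerivData.voltageQ (h : DerivData Ω D a b v₀ v₁ y t) :
    HasDerivAt (fun s => (y s).1.vcq)
      (-D.KVC * (y t).1.vcq + Ω.ωb / Ω.Cf * ((y t).1.itq - itqRef Ω D (y t).1)) t := by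
  convert! h.vcq using 1
  have := Ω.ωb_pos.ne'
  have := Ω.Cf_pos.ne'
  unfold itqRef
  field_simp
  ring

theorem DerivData.currentErrorQ (h : DerivData Ω D a b v₀ (vtqNom Ω D (y t).1 (y t).2.2) y t) :
    HasDerivAt (fun s => (y s).1.itq - itqRef Ω D (y s).1)
      (uq Ω D (y t).1 (y t).2.2
        - (Ω.ωb / Ω.L * ((y t).1.vcq - b) - Ω.ωb * Ω.R / Ω.L * (y t).1.igq)) t := by
  convert! h.itq.sub ((h.igq.add ((h.freq.const_mul Ω.Cf).mul h.vcd)).sub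
    (h.voltageQ.const_mul (Ω.Cf * D.KVC / Ω.ωb))) using 1
  have := Ω.ωb_pos.ne'
  have := Ω.Cf_pos.ne'
  have := Ω.Lf_pos.ne'
  have := Ω.L_pos.ne'
  unfold vtqNom
  generalize itqRef Ω D (y t).1 = ref
  generalize uq Ω D (y t).1 (y t).2.2 = u
  field_simp
  ring

end Tracking

/-- Nonlinear damping dominates the grid-side disturbance. -/
theorem dissipation_le {w l r Kv Kc μ c e s v i g n ζ : ℝ} (hl : 0 < l) (hμ : 0 < μ)
    (hζ : 0 < ζ) (hg : |g| ≤ n) :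
    e * (-Kv * e + c * s) + s * ((-(Kc + (1 + ζ) * w ^ 2 / (4 * μ) * (1 + i ^ 2 + v ^ 2)) * s
        - c * e) - (w / l * (v - g) - w * r / l * i))
      ≤ -(2 * min Kv Kc) * (1 / 2 * e ^ 2 + 1 / 2 * s ^ 2)
        + μ * ((1 + r ^ 2 + n ^ 2) / l ^ 2) / (1 + ζ) := by
  have h1 : min Kv Kc * e ^ 2 ≤ Kv * e ^ 2 :=
    mul_le_mul_of_nonneg_right (min_le_left _ _) (sq_nonneg e)
  have h2 : min Kv Kc * s ^ 2 ≤ Kc * s ^ 2 :=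
    mul_le_mul_of_nonneg_right (min_le_right _ _) (sq_nonneg s)
  set d := -v + g + r * i with hd
  -- Cauchy–Schwarz for d = (v, 1, i)·(-1, g, r); the first factor is exactly the state-dependent
  -- weight in the damping gain.
  have hcs : d ^ 2 ≤ (1 + i ^ 2 + v ^ 2) * (1 + r ^ 2 + n ^ 2) := by
    have hgn : g ^ 2 ≤ n ^ 2 := sq_le_sq' (by linarith [(abs_le.1 hg).1]) (abs_le.1 hg).2
    have h3 : d ^ 2 ≤ (1 + i ^ 2 + v ^ 2) * (1 + r ^ 2 + g ^ 2) := by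
      nlinarith [sq_nonneg (v * g + 1), sq_nonneg (v * r + i), sq_nonneg (g * i - r)]
    refine h3.trans ?_
    gcongr
  set N := 1 + i ^ 2 + v ^ 2 with hN
  have hN0 : 0 < N := by positivity
  -- Young's inequality against the damping: the weight N cancels, leaving a residual that is
  -- independent of the state and shrinks like 1/(1 + ζ).
  have hyoung : s * (w / l * d) - (1 + ζ) * w ^ 2 / (4 * μ) * N * s ^ 2
      ≤ μ * ((1 + r ^ 2 + n ^ 2) / l ^ 2) / (1 + ζ) := by
    have h4 : s * (w / l * d) - (1 + ζ) * w ^ 2 / (4 * μ) * N * s ^ 2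
        ≤ μ * (d ^ 2 / N / l ^ 2) / (1 + ζ) := by
      have e1 : μ * (d ^ 2 / N / l ^ 2) / (1 + ζ)
          - (s * (w / l * d) - (1 + ζ) * w ^ 2 / (4 * μ) * N * s ^ 2)
          = μ / (N * (1 + ζ)) * (d / l - (1 + ζ) * N * w * s / (2 * μ)) ^ 2 := by
        have : (1 + ζ) ≠ 0 := by positivity
        field_simp
        ring
      have e2 : 0 ≤ μ / (N * (1 + ζ)) * (d / l - (1 + ζ) * N * w * s / (2 * μ)) ^ 2 := by
        positivity
      linarith
    refine h4.trans ?_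
    have h5 : d ^ 2 / N ≤ 1 + r ^ 2 + n ^ 2 := by
      rw [div_le_iff₀ hN0]; linarith
    gcongr
  have e3 : w / l * (v - g) - w * r / l * i = -(w / l * d) := by rw [hd]; ring
  rw [e3]
  linarith

/-! ### Energy dissipation while the safety filter is inactive -/

section Trajectory

variable {Ω : Circuit} {D : Design} {vgd vgq : ℝ → ℝ} {T : ℝ} {y : ℝ → FullState}

theorem ae_Wd_deriv_le (hd : IsBoundedSignal vgd) (hy : IsSolutionUpTo Ω D vgd vgq T y) :
    ∀ᵐ t, t ∈ Icc 0 T → t ∉ onSet Ω D y → ∃ d, HasDerivAt (fun s => Wd Ω D (y s).1) d t ∧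
      d ≤ -(2 * min D.KVC D.KCC) * Wd Ω D (y t).1
        + D.μd * ((1 + Ω.R ^ 2 + (supNorm vgd : ℝ) ^ 2) / Ω.L ^ 2) / (1 + Real.exp (y t).2.1) := by
  filter_upwards [ae_derivData hy, hd.ae_abs_le] with t ht ha hmem hoff
  have hs : 0 ≤ slack Ω D (y t) := by
    by_contra! hneg
    exact hoff ⟨hmem.1, hneg⟩
  have h := ht hmem
  rw [safetyFilter_of_nonneg Ω D hs] at h
  replace h : DerivData Ω D (vgd t) (vgq t) (vtdNom Ω D (y t).1 (y t).2.1) _ y t := h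
  refine ⟨_, ((h.voltageError.pow 2).const_mul (1 / 2)).add
    ((h.currentErrorD.pow 2).const_mul (1 / 2)), ?_⟩
  refine le_trans (le_of_eq ?_) (dissipation_le (w := Ω.ωb) (c := Ω.ωb / Ω.Cf)
    (v := (y t).1.vcd) (i := (y t).1.igd) Ω.L_pos D.μd_pos (Real.exp_pos _) (ha hmem.1))
  rw [ud]
  ring

theorem ae_Wq_deriv_le (hq : IsBoundedSignal vgq) (hy : IsSolutionUpTo Ω D vgd vgq T y) :
    ∀ᵐ t, t ∈ Icc 0 T → t ∉ onSet Ω D y → ∃ d, HasDerivAt (fun s => Wq Ω D (y s).1) d t ∧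
      d ≤ -(2 * min D.KVC D.KCC) * Wq Ω D (y t).1
        + D.μq * ((1 + Ω.R ^ 2 + (supNorm vgq : ℝ) ^ 2) / Ω.L ^ 2) / (1 + Real.exp (y t).2.2) := by
  filter_upwards [ae_derivData hy, hq.ae_abs_le] with t ht ha hmem hoff
  have hs : 0 ≤ slack Ω D (y t) := by
    by_contra! hneg
    exact hoff ⟨hmem.1, hneg⟩
  have h := ht hmem
  rw [safetyFilter_of_nonneg Ω D hs] at h
  replace h : DerivData Ω D (vgd t) (vgq t) _ (vtqNom Ω D (y t).1 (y t).2.2) y t := h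
  refine ⟨_, ((h.voltageQ.pow 2).const_mul (1 / 2)).add
    ((h.currentErrorQ.pow 2).const_mul (1 / 2)), ?_⟩
  refine le_trans (le_of_eq ?_) (dissipation_le (w := Ω.ωb) (c := Ω.ωb / Ω.Cf)
    (v := (y t).1.vcq) (i := (y t).1.igq) Ω.L_pos D.μq_pos (Real.exp_pos _) (ha hmem.1))
  rw [uq]
  ring

/-! ### Boundedness of the full state on bounded intervals -/

/-- Continuity on closed balls. M is chosen radius by radius with no regularity, which suffices
because only B₂ has to be continuous. -/
theorem exists_energy_bound (Ω : Circuit) (D : Design) :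
    ∃ M : ℝ → ℝ, ∀ r x, ‖x‖ ≤ r → Wd Ω D x ≤ M r ∧ Wq Ω D x ≤ M r := by
  have h : ∀ r : ℝ, ∃ M : ℝ, ∀ x : State, ‖x‖ ≤ r → Wd Ω D x ≤ M ∧ Wq Ω D x ≤ M := fun r => by
    obtain ⟨C₁, h₁⟩ := (isCompact_closedBall (0 : State) r).exists_bound_of_continuousOn
      (locallyLipschitz_Wd Ω D).continuous.continuousOn
    obtain ⟨C₂, h₂⟩ := (isCompact_closedBall (0 : State) r).exists_bound_of_continuousOn
      (locallyLipschitz_Wq Ω D).continuous.continuousOn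
    refine ⟨max C₁ C₂, fun x hx => ?_⟩
    have hx' : x ∈ Metric.closedBall 0 r := mem_closedBall_zero_iff.2 hx
    exact ⟨((le_abs_self _).trans (h₁ x hx')).trans (le_max_left _ _),
      ((le_abs_self _).trans (h₂ x hx')).trans (le_max_right _ _)⟩
  choose M hM using h
  exact ⟨M, hM⟩

theorem Wd_nonneg (x : State) : 0 ≤ Wd Ω D x := by unfold Wd; positivity

theorem Wq_nonneg (x : State) : 0 ≤ Wq Ω D x := by unfold Wq; positivity

theorem norm_state_le {x : State} {I b : ℝ} (hI : 0 ≤ I) (h : x.itd ^ 2 + x.itq ^ 2 ≤ I ^ 2)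
    (hb : ‖x.rest‖ ≤ b) : ‖x‖ ≤ I + b := by
  have hb0 : 0 ≤ b := (norm_nonneg _).trans hb
  refine le_of_sq_le_sq ?_ (by positivity)
  have h1 : ‖x‖ ^ 2 = x.itd ^ 2 + x.itq ^ 2 + ‖x.rest‖ ^ 2 := by
    rw [norm_rest_sq, EuclideanSpace.norm_sq_eq]
    simp [Fin.sum_univ_succ, State.vcd, State.vcq, State.itd, State.itq, State.igd, State.igq,
      State.q₁, State.q₂, State.p₁, State.p₂]
    ring
  have h2 : ‖x.rest‖ ^ 2 ≤ b ^ 2 := by gcongr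
  nlinarith [mul_nonneg hI hb0]

/-- The exponential of an adaptive gain integrates the excess energy. -/
theorem hasDerivAt_exp_gain {z : ℝ → ℝ} {Γ p t : ℝ}
    (h : HasDerivAt z (Γ * Real.exp (-z t) * p) t) :
    HasDerivAt (fun s => Real.exp (z s)) (Γ * p) t := by
  convert! h.exp using 1
  rw [Real.exp_neg]
  field_simp

/-- Since (e^z)' = Γ max(W - ε, 0) ≤ ΓM, finite-time escape of a gain is impossible, with no
assumption on the activity of the filter. -/
theorem gain_bounds {z W : ℝ → ℝ} {Γ ε M : ℝ} (hT : 0 ≤ T) (hΓ : 0 < Γ) (hε : 0 < ε)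
    (hz : AbsolutelyContinuousOnInterval z 0 T)
    (hder : ∀ᵐ t, t ∈ Icc 0 T → HasDerivAt z (Γ * Real.exp (-z t) * max (W t - ε) 0) t)
    (hW0 : ∀ t ∈ Icc 0 T, 0 ≤ W t) (hW : ∀ t ∈ Icc 0 T, W t ≤ M) :
    z 0 ≤ z T ∧ Real.exp (z T) ≤ Real.exp (z 0) + Γ * M * T := by
  constructor
  · refine hz.le_of_ae_hasDerivAt_nonneg hT ?_
    filter_upwards [hder] with t ht hmem
    exact ⟨_, ht hmem, by positivity⟩
  · have hac : AbsolutelyContinuousOnInterval (fun t => Real.exp (z t)) 0 T :=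
      hz.comp_locallyLipschitz hz.continuousOn (g := Real.exp) (by fun_prop)
    have := hac.le_add_of_ae_deriv_le hT (C := Γ * M) (by
      filter_upwards [hder] with t ht hmem
      refine ⟨_, hasDerivAt_exp_gain (ht hmem), ?_⟩
      have h0 := hW0 t hmem
      have h1 := hW t hmem
      gcongr
      exact max_le (by linarith) (by linarith))
    simpa using this

theorem abs_le_of_exp_le {z₀ z c : ℝ} (h0 : z₀ ≤ z) (h : Real.exp z ≤ c) :
    |z| ≤ |z₀| + |Real.log c| := by
  have h1 : z ≤ Real.log c := by
    rw [Real.le_log_iff_exp_le ((Real.exp_pos z).trans_le h)]; exact h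
  refine abs_le.2 ⟨?_, ?_⟩
  · linarith [neg_abs_le z₀, abs_nonneg (Real.log c)]
  · linarith [le_abs_self (Real.log c), abs_nonneg z₀]

/-- The a priori bound on [0, T] combines the state bounds, uniform in time, with the linear growth
of the exponentiated gains. -/
theorem exists_solution (Ω : Circuit) (D : Design) {vgd vgq : ℝ → ℝ} (hd : IsBoundedSignal vgd)
    (hq : IsBoundedSignal vgq) {x₀ : State} (hx₀ : x₀ ∈ safeSet D) (zd₀ zq₀ : ℝ) :
    ∃ y, (∀ T, 0 ≤ T → IsSolutionUpTo Ω D vgd vgq T y) ∧ y 0 = (x₀, zd₀, zq₀) := by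
  obtain ⟨B, -, hB⟩ := exists_rest_bound Ω D
  obtain ⟨M, hM⟩ := exists_energy_bound Ω D
  refine exists_global_forcedSolution (locallyLipschitz_closedLoopField Ω D)
    (V := gridPrimitive Ω vgd vgq) (fun T hT => absolutelyContinuous_gridPrimitive Ω hd hq hT)
    (ae_hasDerivAt_gridPrimitive Ω hd hq) (by simp [gridPrimitive]) _ fun T hT => ?_
  set ρ := D.Imax + B (x₀, supNorm vgd, supNorm vgq) with hρ
  have hmono : ∀ (z₀ Γ τ : ℝ), 0 < Γ → 0 ≤ M ρ → 0 ≤ τ → τ ≤ T →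
      Real.exp z₀ + Γ * M ρ * τ ≤ Real.exp z₀ + Γ * M ρ * T := fun z₀ Γ τ h1 h2 h3 h4 => by gcongr
  refine ⟨max ρ (max (|zd₀| + |Real.log (Real.exp zd₀ + D.Γd * M ρ * T)|)
    (|zq₀| + |Real.log (Real.exp zq₀ + D.Γq * M ρ * T)|)), fun τ hτ hτT y hy hy0 => ?_⟩
  have hsafe : (y 0).1 ∈ safeSet D := by rw [hy0]; exact hx₀
  have hx : ∀ t ∈ Icc 0 τ, ‖(y t).1‖ ≤ ρ := fun t ht => by
    have h1 := current_sq_le ht.1 (hy.mono ht.1 ht.2) hsafe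
    have h2 := hB vgd vgq hd hq t ht.1 y (hy.mono ht.1 ht.2) hsafe
    rw [hy0] at h2
    exact norm_state_le D.Imax_pos.le h1 h2
  have hM0 : 0 ≤ M ρ := (Wd_nonneg _).trans (hM ρ _ (hx 0 ⟨le_rfl, hτ⟩)).1
  have hzd := gain_bounds hτ D.Γd_pos D.ε_pos
    (hy.absolutelyContinuous_comp (g := fun z : FullState => z.2.1) (by fun_prop))
    (W := fun t => Wd Ω D (y t).1)
    (by filter_upwards [ae_derivData hy] with t ht hmem using (ht hmem).zd)
    (fun t _ => Wd_nonneg _) (fun t ht => (hM ρ _ (hx t ht)).1)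
  have hzq := gain_bounds hτ D.Γq_pos D.ε_pos
    (hy.absolutelyContinuous_comp (g := fun z : FullState => z.2.2) (by fun_prop))
    (W := fun t => Wq Ω D (y t).1)
    (by filter_upwards [ae_derivData hy] with t ht hmem using (ht hmem).zq)
    (fun t _ => Wq_nonneg _) (fun t ht => (hM ρ _ (hx t ht)).2)
  simp only [hy0] at hzd hzq
  refine max_le_max (hx τ ⟨hτ, le_rfl⟩) (max_le_max ?_ ?_)
  · exact abs_le_of_exp_le hzd.1 (hzd.2.trans (hmono _ _ _ D.Γd_pos hM0 hτ hτT))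
  · exact abs_le_of_exp_le hzq.1 (hzq.2.trans (hmono _ _ _ D.Γq_pos hM0 hτ hτT))

end Trajectory

end GFM

/-! ### Integrals over unions of intervals -/

/-- The integral of the derivative over an interval of unspecified type, contained in `(a, b]`,
is at most the oscillation of the function. -/
theorem AbsolutelyContinuousOnInterval.setIntegral_deriv_le {w : ℝ → ℝ} {a b M : ℝ}
    (hw : AbsolutelyContinuousOnInterval w a b) (hM : ∀ t ∈ Icc a b, 0 ≤ w t ∧ w t ≤ M)
    (hM0 : 0 ≤ M) {J : Set ℝ} (hJ : J.OrdConnected) (hJs : J ⊆ Ioc a b) :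
    ∫ t in J, deriv w t ≤ M := by
  rcases J.eq_empty_or_nonempty with rfl | hne
  · simpa using hM0
  have hbelow : BddBelow J := ⟨a, fun t ht => (hJs ht).1.le⟩
  have habove : BddAbove J := ⟨b, fun t ht => (hJs ht).2⟩
  obtain ⟨t₀, ht₀⟩ := hne
  have hc : a ≤ sInf J := le_csInf ⟨t₀, ht₀⟩ fun t ht => (hJs ht).1.le
  have hd : sSup J ≤ b := csSup_le ⟨t₀, ht₀⟩ fun t ht => (hJs ht).2
  have hcd : sInf J ≤ sSup J := (csInf_le hbelow ht₀).trans (le_csSup habove ht₀)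
  have hioo : Ioo (sInf J) (sSup J) ⊆ J := by
    intro t ht
    obtain ⟨r, hr, hrt⟩ := exists_lt_of_csInf_lt ⟨t₀, ht₀⟩ ht.1
    obtain ⟨s, hs, hts⟩ := exists_lt_of_lt_csSup ⟨t₀, ht₀⟩ ht.2
    exact hJ.out hr hs ⟨hrt.le, hts.le⟩
  have hicc : J ⊆ Icc (sInf J) (sSup J) := fun t ht => ⟨csInf_le hbelow ht, le_csSup habove ht⟩
  -- An episode may contain its endpoints or not; up to a null set it is the interval from its
  -- infimum to its supremum.
  have hae : J =ᵐ[volume] Ioc (sInf J) (sSup J) :=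
    (LE.le.eventuallyLE hicc |>.trans Ioc_ae_eq_Icc.symm.le).antisymm
      (Ioo_ae_eq_Ioc.symm.le.trans (LE.le.eventuallyLE hioo))
  rw [setIntegral_congr_set hae, ← intervalIntegral.integral_of_le hcd]
  have hsub : uIcc (sInf J) (sSup J) ⊆ uIcc a b := by
    rw [uIcc_of_le hcd, uIcc_of_le (hc.trans (hcd.trans hd))]
    exact Icc_subset_Icc hc hd
  rw [(hw.mono hsub).integral_deriv_eq_sub]
  linarith [(hM (sInf J) ⟨hc, hcd.trans hd⟩).1, (hM (sSup J) ⟨hc.trans hcd, hd⟩).2]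

/-- A function that decays exponentially outside finitely many intervals has a bounded integral. -/
theorem AbsolutelyContinuousOnInterval.integral_le_of_decay_off {w : ℝ → ℝ} {a b M k τ : ℝ}
    (hab : a ≤ b) (hw : AbsolutelyContinuousOnInterval w a b)
    (hM : ∀ t ∈ Icc a b, 0 ≤ w t ∧ w t ≤ M) (hk : 0 < k) (𝒥 : Finset (Set ℝ))
    (hJ : ∀ J ∈ 𝒥, J.OrdConnected) (hdisj : (𝒥 : Set (Set ℝ)).PairwiseDisjoint id)
    (hvol : volume (⋃ J ∈ 𝒥, J) ≤ ENNReal.ofReal τ) (hτ : 0 ≤ τ)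
    (hdec : ∀ᵐ t, t ∈ Icc a b → t ∉ ⋃ J ∈ 𝒥, J → deriv w t ≤ -k * w t) :
    ∫ t in a..b, w t ≤ M * τ + (𝒥.card + 1) * M / k := by
  have hM0 : 0 ≤ M := (hM a ⟨le_rfl, hab⟩).1.trans (hM a ⟨le_rfl, hab⟩).2
  set S : Set ℝ := ⋃ J ∈ 𝒥, J with hS
  have mS : MeasurableSet S := Finset.measurableSet_biUnion _ fun J h => (hJ J h).measurableSet
  have iw : IntegrableOn w (Ioc a b) := by
    rw [← intervalIntegrable_iff_integrableOn_Ioc_of_le hab]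
    exact hw.continuousOn.intervalIntegrable
  have idw : IntegrableOn (deriv w) (Ioc a b) := by
    rw [← intervalIntegrable_iff_integrableOn_Ioc_of_le hab]
    exact hw.intervalIntegrable_deriv
  have hsplit_d : (∫ t in Ioc a b ∩ S, deriv w t) + (∫ t in Ioc a b \ S, deriv w t) =
      w b - w a := by
    rw [integral_inter_add_sdiff mS idw, ← intervalIntegral.integral_of_le hab,
      hw.integral_deriv_eq_sub]
  have hsplit_w : (∫ t in Ioc a b ∩ S, w t) + (∫ t in Ioc a b \ S, w t) = ∫ t in a..b, w t := by
    rw [integral_inter_add_sdiff mS iw, ← intervalIntegral.integral_of_le hab]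
  have hon_d : ∫ t in Ioc a b ∩ S, deriv w t ≤ 𝒥.card * M := by
    have e : Ioc a b ∩ S = ⋃ J ∈ 𝒥, (Ioc a b ∩ J) := by rw [hS, inter_iUnion₂]
    rw [e, integral_biUnion_finset 𝒥 (fun J h => measurableSet_Ioc.inter (hJ J h).measurableSet)
      (fun J hJ J' hJ' hne => (hdisj hJ hJ' hne).mono inter_subset_right inter_subset_right)
      (fun J _ => idw.mono_set inter_subset_left)]
    refine (Finset.sum_le_card_nsmul 𝒥 _ M fun J h => ?_).trans (le_of_eq (nsmul_eq_mul _ _))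
    exact hw.setIntegral_deriv_le hM hM0 (ordConnected_Ioc.inter (hJ J h)) inter_subset_left
  have hon_w : ∫ t in Ioc a b ∩ S, w t ≤ M * τ := by
    have hv : volume (Ioc a b ∩ S) ≤ ENNReal.ofReal τ :=
      (measure_mono inter_subset_right).trans hvol
    have hfin : volume (Ioc a b ∩ S) < ⊤ := hv.trans_lt ENNReal.ofReal_lt_top
    calc ∫ t in Ioc a b ∩ S, w t ≤ ∫ _ in Ioc a b ∩ S, M := by
          refine setIntegral_mono_on (iw.mono_set inter_subset_left)
            (integrableOn_const hfin.ne) (measurableSet_Ioc.inter mS) fun t ht => ?_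
          exact (hM t (Ioc_subset_Icc_self ht.1)).2
      _ = M * (volume (Ioc a b ∩ S)).toReal := by
          rw [setIntegral_const, smul_eq_mul, mul_comm]; rfl
      _ ≤ M * τ := by
          gcongr
          exact ENNReal.toReal_le_of_le_ofReal hτ hv
  have hoff : ∫ t in Ioc a b \ S, deriv w t ≤ -k * ∫ t in Ioc a b \ S, w t := by
    rw [← integral_const_mul]
    refine setIntegral_mono_on_ae (idw.mono_set sdiff_subset)
      ((iw.mono_set sdiff_subset).const_mul _) (measurableSet_Ioc.diff mS) ?_
    filter_upwards [hdec] with t ht hmem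
    exact ht (Ioc_subset_Icc_self hmem.1) hmem.2
  have hwa := (hM a ⟨le_rfl, hab⟩).2
  have hwb := (hM b ⟨hab, le_rfl⟩).1
  -- Balance of w: the loss off S, at least k∫w, is at most the initial value (at most M) plus the
  -- increase on S (at most M for each interval). This is the origin of `card + 1`.
  have hoff_w : ∫ t in Ioc a b \ S, w t ≤ (𝒥.card + 1) * M / k := by
    rw [le_div_iff₀ hk]
    linarith
  linarith

namespace GFM

/-! ### Boundedness of the adaptive gains -/

section Gains

variable {Ω : Circuit} {D : Design}

/-- The truncated energy `max (W - ε) 0` decays at every time at which `W` dissipates. -/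
theorem deriv_excess_le {W : ℝ → ℝ} {ε k d t : ℝ} (hW : HasDerivAt W d t)
    (hd : d ≤ -k * (W t - ε)) :
    deriv (fun s => max (W s - ε) 0) t ≤ -k * max (W t - ε) 0 := by
  rcases le_or_gt (W t) ε with h | h
  · have h0 : max (W t - ε) 0 = 0 := max_eq_right (by linarith)
    -- Where W ≤ ε the truncation is at its global minimum, so `deriv` vanishes there even at a
    -- kink.
    have hmin : IsLocalMin (fun s => max (W s - ε) 0) t :=
      Filter.Eventually.of_forall fun s => h0.le.trans (le_max_right _ _)
    rw [hmin.deriv_eq_zero, h0, mul_zero]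
  · have hev : (fun s => max (W s - ε) 0) =ᶠ[𝓝 t] fun s => W s - ε := by
      filter_upwards [hW.continuousAt.eventually_const_lt h] with s hs
      exact max_eq_left (by linarith)
    rw [hev.deriv_eq, (hW.sub_const ε).deriv, max_eq_left (by linarith)]
    exact hd

/-- The gain bound over finitely many activation intervals. -/
theorem exp_gain_le {z W : ℝ → ℝ} {Γ ε M σ ϑ τ T : ℝ} (hT : 0 ≤ T) (hΓ : 0 < Γ) (hε : 0 < ε)
    (hσ : 0 < σ) (hτ : 0 ≤ τ)
    (hz : AbsolutelyContinuousOnInterval z 0 T) (hWac : AbsolutelyContinuousOnInterval W 0 T)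
    (hder : ∀ᵐ t, t ∈ Icc 0 T → HasDerivAt z (Γ * Real.exp (-z t) * max (W t - ε) 0) t)
    (hW0 : ∀ t ∈ Icc 0 T, 0 ≤ W t) (hW : ∀ t ∈ Icc 0 T, W t ≤ M)
    (𝒥 : Finset (Set ℝ)) (hJ : ∀ J ∈ 𝒥, J.OrdConnected)
    (hdisj : (𝒥 : Set (Set ℝ)).PairwiseDisjoint id)
    (hvol : volume (⋃ J ∈ 𝒥, J) ≤ ENNReal.ofReal τ)
    (hdec : ∀ᵐ t, t ∈ Icc 0 T → t ∉ ⋃ J ∈ 𝒥, J →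
      ∃ d, HasDerivAt W d t ∧ d ≤ -σ * W t + ϑ / (1 + Real.exp (z t))) :
    Real.exp (z T) ≤ max (Real.exp (z 0)) (ϑ / (σ * ε)) +
      Γ * (M * τ + (𝒥.card + 1) * M / σ) := by
  have hM0 : 0 ≤ M := (hW0 0 ⟨le_rfl, hT⟩).trans (hW 0 ⟨le_rfl, hT⟩)
  set w : ℝ → ℝ := fun s => max (W s - ε) 0 with hw
  have hlip : LocallyLipschitz fun x : ℝ => max (x - ε) 0 := by fun_prop
  have acw : AbsolutelyContinuousOnInterval w 0 T :=
    hWac.comp_locallyLipschitz hWac.continuousOn (g := fun x => max (x - ε) 0) hlip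
  have acE : AbsolutelyContinuousOnInterval (fun t => Real.exp (z t)) 0 T :=
    hz.comp_locallyLipschitz hz.continuousOn (g := Real.exp) (by fun_prop)
  have hsub : ∀ r ∈ Icc 0 T, uIcc r T ⊆ uIcc 0 T := fun r hr => by
    rw [uIcc_of_le hr.2, uIcc_of_le hT]; exact Icc_subset_Icc_left hr.1
  have hmono : ∀ r ∈ Icc 0 T, ∀ s ∈ Icc 0 T, r ≤ s → z r ≤ z s := fun r hr s hs hrs => by
    refine (hz.mono ?_).le_of_ae_hasDerivAt_nonneg hrs ?_
    · rw [uIcc_of_le hrs, uIcc_of_le hT]; exact Icc_subset_Icc hr.1 hs.2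
    · filter_upwards [hder] with t ht hmem
      exact ⟨_, ht ⟨hr.1.trans hmem.1, hmem.2.trans hs.2⟩, by positivity⟩
  -- The gain is monotone, so above the threshold at r it stays above it, and the disturbance is at
  -- most σε from r on. The excess then decays off the episodes, and its integral controls the
  -- growth of e^z.
  have htail : ∀ r ∈ Icc 0 T, ϑ / (σ * ε) ≤ Real.exp (z r) →
      Real.exp (z T) ≤ Real.exp (z r) + Γ * (M * τ + (𝒥.card + 1) * M / σ) := by
    intro r hr hzr
    have h1 : ∫ t in r..T, deriv (fun t => Real.exp (z t)) t = Real.exp (z T) - Real.exp (z r) :=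
      (acE.mono (hsub r hr)).integral_deriv_eq_sub
    have h2 : ∫ t in r..T, deriv (fun t => Real.exp (z t)) t = Γ * ∫ t in r..T, w t := by
      rw [← intervalIntegral.integral_const_mul]
      refine intervalIntegral.integral_congr_ae ?_
      filter_upwards [hder] with t ht hmem
      rw [uIoc_of_le hr.2] at hmem
      exact (hasDerivAt_exp_gain (ht ⟨hr.1.trans hmem.1.le, hmem.2⟩)).deriv
    have h3 : ∫ t in r..T, w t ≤ M * τ + (𝒥.card + 1) * M / σ := by
      refine (acw.mono (hsub r hr)).integral_le_of_decay_off hr.2 (fun t ht => ?_) hσ 𝒥 hJ hdisj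
        hvol hτ ?_
      · have := hW t ⟨hr.1.trans ht.1, ht.2⟩
        exact ⟨le_max_right _ _, max_le (by linarith) hM0⟩
      · filter_upwards [hdec] with t ht hmem hoff
        have hmem' : t ∈ Icc 0 T := ⟨hr.1.trans hmem.1, hmem.2⟩
        obtain ⟨d, hd, hle⟩ := ht hmem' hoff
        refine deriv_excess_le hd (hle.trans ?_)
        have hzt : ϑ / (σ * ε) ≤ Real.exp (z t) :=
          hzr.trans (Real.exp_le_exp.2 (hmono r hr t hmem' hmem.1))
        have : ϑ / (1 + Real.exp (z t)) ≤ σ * ε := by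
          rw [div_le_iff₀ (by positivity)] at hzt ⊢
          nlinarith [mul_pos hσ hε]
        linarith
    have h4 : Γ * ∫ t in r..T, w t ≤ Γ * (M * τ + (𝒥.card + 1) * M / σ) :=
      mul_le_mul_of_nonneg_left h3 hΓ.le
    linarith
  have hnn : 0 ≤ Γ * (M * τ + (𝒥.card + 1) * M / σ) := by positivity
  -- Three cases: above the threshold from the start, never above it, or crossing it at a time r
  -- where e^z equals it exactly.
  rcases le_or_gt (ϑ / (σ * ε)) (Real.exp (z 0)) with h | h
  · exact (htail 0 ⟨le_rfl, hT⟩ h).trans (add_le_add (le_max_left _ _) le_rfl)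
  · rcases le_or_gt (Real.exp (z T)) (ϑ / (σ * ε)) with h' | h'
    · linarith [le_max_right (Real.exp (z 0)) (ϑ / (σ * ε))]
    · have cE : ContinuousOn (fun t => Real.exp (z t)) (Icc 0 T) := by
        have := acE.continuousOn
        rwa [uIcc_of_le hT] at this
      obtain ⟨r, hr, hzr⟩ := intermediate_value_Icc hT cE ⟨h.le, h'.le⟩
      have hzr' : Real.exp (z r) = ϑ / (σ * ε) := hzr
      refine (htail r hr hzr'.ge).trans (add_le_add ?_ le_rfl)
      rw [hzr']
      exact le_max_right _ _

theorem gainBoundedBy_of_exp_le {z : ℝ → ℝ} {C : ℝ} (hmono : MonotoneOn z (Ici 0))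
    (h : ∀ t, 0 ≤ t → Real.exp (z t) ≤ C) {B : ℝ} (hB : Real.log C ≤ B) : GainBoundedBy z B := by
  have hle : ∀ t, 0 ≤ t → z t ≤ Real.log C := fun t ht =>
    (Real.le_log_iff_exp_le ((Real.exp_pos _).trans_le (h t ht))).2 (h t ht)
  -- Freezing z at negative times, where it is arbitrary, gives a globally monotone function whose
  -- limit is its supremum.
  have hm : Monotone fun t => z (max t 0) := fun s t hst =>
    hmono (le_max_right s 0) (le_max_right t 0) (max_le_max hst le_rfl)
  have hbdd : BddAbove (range fun t => z (max t 0)) :=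
    ⟨Real.log C, by rintro _ ⟨t, rfl⟩; exact hle _ (le_max_right _ _)⟩
  refine ⟨hmono, ⨆ t, z (max t 0), ?_, fun t ht => ⟨hmono (mem_Ici.2 le_rfl) ht ht, ?_⟩, ?_⟩
  · refine (tendsto_atTop_ciSup hm hbdd).congr' ?_
    filter_upwards [eventually_ge_atTop 0] with t ht
    rw [max_eq_left ht]
  · have := le_ciSup hbdd t
    simpa only [max_eq_left ht] using this
  · exact (ciSup_le fun t => hle _ (le_max_right _ _)).trans hB

/-- Finitely many activation episodes partition the activation set into disjoint intervals. -/
theorem exists_finset_episodes {y : ℝ → FullState} {N : ℕ} {T : ℝ≥0}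
    (hN : episodeCount Ω D y ≤ N) (hT : totalOnTime Ω D y ≤ T) :
    ∃ 𝒥 : Finset (Set ℝ), (∀ J ∈ 𝒥, J.OrdConnected) ∧
      (𝒥 : Set (Set ℝ)).PairwiseDisjoint id ∧ volume (⋃ J ∈ 𝒥, J) ≤ ENNReal.ofReal T ∧
      (⋃ J ∈ 𝒥, J) = onSet Ω D y ∧ 𝒥.card ≤ N := by
  have hfin : (episodes Ω D y).Finite := Set.finite_of_encard_le_coe hN
  refine ⟨hfin.toFinset, ?_, ?_, ?_, ?_, ?_⟩
  · intro J hJ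
    obtain ⟨t, -, rfl⟩ := hfin.mem_toFinset.1 hJ
    exact inferInstance
  · intro J hJ J' hJ' hne
    obtain ⟨t, -, rfl⟩ := hfin.mem_toFinset.1 hJ
    obtain ⟨t', -, rfl⟩ := hfin.mem_toFinset.1 hJ'
    refine Set.disjoint_left.2 fun s hs hs' => hne ?_
    exact (ordConnectedComponent_eq hs).trans (ordConnectedComponent_eq hs').symm
  · rw [ENNReal.ofReal_coe_nnreal]
    refine le_trans ?_ hT
    have : (⋃ J ∈ hfin.toFinset, J) = ⋃ J ∈ episodes Ω D y, J := by simp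
    rw [this, totalOnTime]
    exact measure_biUnion_le volume hfin.countable _
  · ext s
    simp only [Set.Finite.mem_toFinset, mem_iUnion, exists_prop]
    constructor
    · rintro ⟨J, ⟨t, -, rfl⟩, hs⟩
      exact ordConnectedComponent_subset hs
    · intro hs
      exact ⟨_, ⟨s, hs, rfl⟩, self_mem_ordConnectedComponent.2 hs⟩
  · have : ((hfin.toFinset.card : ℕ) : ℕ∞) ≤ N := by
      rw [← hfin.encard_eq_coe_toFinset_card]; exact hN
    exact_mod_cast this

end Gains

end GFM

/-! ### The main theorem -/

theorem theorem4 (Ω : GFM.Circuit) (D : GFM.Design) :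
    ∃ B₂ : GFM.State × ℝ≥0 × ℝ≥0 → ℝ≥0, Continuous B₂ ∧
    ∃ B₃ : GFM.State × ℝ × ℝ × ℝ≥0 × ℝ≥0 × ℕ × ℝ≥0 → ℝ≥0,
      ∀ vgd vgq : ℝ → ℝ, GFM.IsBoundedSignal vgd → GFM.IsBoundedSignal vgq →
      ∀ x₀ ∈ GFM.safeSet D, ∀ zd₀ zq₀ : ℝ,
        ∃ y : ℝ → GFM.FullState,
          -- `y` is the unique solution with the given initial condition
          (GFM.IsSolution Ω D vgd vgq y ∧ y 0 = (x₀, zd₀, zq₀)) ∧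
          (∀ y' : ℝ → GFM.FullState, GFM.IsSolution Ω D vgd vgq y' → y' 0 = (x₀, zd₀, zq₀) →
            Set.EqOn y' y (Set.Ici 0)) ∧
          -- safety and boundedness of the remaining physical states
          (∀ t : ℝ, 0 ≤ t →
            √((y t).1.itd ^ 2 + (y t).1.itq ^ 2) ≤ D.Imax ∧
            ‖(y t).1.rest‖ ≤ B₂ (x₀, GFM.supNorm vgd, GFM.supNorm vgq)) ∧
          -- convergence and boundedness of the adaptive gains
          (∀ (N : ℕ) (T : ℝ≥0), GFM.episodeCount Ω D y ≤ N → GFM.totalOnTime Ω D y ≤ T →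
            GFM.GainBoundedBy (fun t => (y t).2.1)
              (B₃ (x₀, zd₀, zq₀, GFM.supNorm vgd, GFM.supNorm vgq, N, T)) ∧
            GFM.GainBoundedBy (fun t => (y t).2.2)
              (B₃ (x₀, zd₀, zq₀, GFM.supNorm vgd, GFM.supNorm vgq, N, T))) := by
  obtain ⟨B, hBc, hB⟩ := GFM.exists_rest_bound Ω D
  obtain ⟨M, hM⟩ := GFM.exists_energy_bound Ω D
  set σ := 2 * min D.KVC D.KCC with hσ
  have hσ0 : 0 < σ := mul_pos two_pos (lt_min D.KVC_pos D.KCC_pos)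
  -- The bound of `exp_gain_le` with the number of intervals replaced by N; m is the energy bound on
  -- the ball of radius I_max + B₂ that contains the physical state. B₃ is the larger logarithm over
  -- the two axes.
  let gainCap : ℝ → ℝ → ℝ → ℝ≥0 → ℝ → ℕ → ℝ≥0 → ℝ := fun Γ μ z₀ n m N T =>
    max (Real.exp z₀) (μ * ((1 + Ω.R ^ 2 + (n : ℝ) ^ 2) / Ω.L ^ 2) / (σ * D.ε))
      + Γ * (m * T + (N + 1) * m / σ)
  refine ⟨B, hBc, fun p => (max
    (Real.log (gainCap D.Γd D.μd p.2.1 p.2.2.2.1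
      (M (D.Imax + B (p.1, p.2.2.2.1, p.2.2.2.2.1))) p.2.2.2.2.2.1 p.2.2.2.2.2.2))
    (Real.log (gainCap D.Γq D.μq p.2.2.1 p.2.2.2.2.1
      (M (D.Imax + B (p.1, p.2.2.2.1, p.2.2.2.2.1))) p.2.2.2.2.2.1 p.2.2.2.2.2.2))).toNNReal, ?_⟩
  intro vgd vgq hd hq x₀ hx₀ zd₀ zq₀
  obtain ⟨y, hy, hy0⟩ := GFM.exists_solution Ω D hd hq hx₀ zd₀ zq₀
  have hsafe : (y 0).1 ∈ GFM.safeSet D := by rw [hy0]; exact hx₀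
  have hI : ∀ t, 0 ≤ t → (y t).1.itd ^ 2 + (y t).1.itq ^ 2 ≤ D.Imax ^ 2 := fun t ht =>
    GFM.current_sq_le ht (hy t ht) hsafe
  have hrest : ∀ t, 0 ≤ t → ‖(y t).1.rest‖ ≤ B (x₀, GFM.supNorm vgd, GFM.supNorm vgq) :=
    fun t ht => by
      have := hB vgd vgq hd hq t ht y (hy t ht) hsafe
      rwa [hy0] at this
  refine ⟨y, ⟨(GFM.isSolution_iff Ω D).2 hy, hy0⟩, fun y' hy' hy0' t ht => ?_,
    fun t ht => ⟨Real.sqrt_le_iff.2 ⟨D.Imax_pos.le, hI t ht⟩, hrest t ht⟩, fun N T hN hT => ?_⟩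
  · exact ((GFM.isSolution_iff Ω D).1 hy' t ht).eqOn (GFM.locallyLipschitz_closedLoopField Ω D) ht
      (hy t ht) (hy0'.trans hy0.symm) ⟨ht, le_rfl⟩
  set ρ := D.Imax + B (x₀, GFM.supNorm vgd, GFM.supNorm vgq) with hρ
  have hx : ∀ t, 0 ≤ t → ‖(y t).1‖ ≤ ρ := fun t ht =>
    GFM.norm_state_le D.Imax_pos.le (hI t ht) (hrest t ht)
  have hM0 : 0 ≤ M ρ := (GFM.Wd_nonneg _).trans (hM ρ _ (hx 0 le_rfl)).1
  obtain ⟨𝒥, hJ, hdisj, hvol, hunion, hcard⟩ := GFM.exists_finset_episodes hN hT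
  have hcap : ∀ {Γ : ℝ}, 0 < Γ → ∀ c : ℝ, c + Γ * (M ρ * T + (𝒥.card + 1) * M ρ / σ) ≤
      c + Γ * (M ρ * T + (N + 1) * M ρ / σ) := fun hΓ c => by gcongr
  have hmono : ∀ {g : GFM.FullState → ℝ}, LocallyLipschitz g →
      (∀ t, 0 ≤ t → ∀ᵐ s, s ∈ Icc 0 t → ∃ d, HasDerivAt (fun s => g (y s)) d s ∧ 0 ≤ d) →
      MonotoneOn (fun t => g (y t)) (Ici 0) := fun hg h s hs t ht hst => by
    refine (((hy t ht).absolutelyContinuous_comp hg).mono ?_).le_of_ae_hasDerivAt_nonneg hst ?_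
    · rw [uIcc_of_le hst, uIcc_of_le (mem_Ici.1 ht)]
      exact Icc_subset_Icc_left hs
    · filter_upwards [h t ht] with r hr hmem
      exact hr ⟨(mem_Ici.1 hs).trans hmem.1, hmem.2⟩
  constructor
  · refine GFM.gainBoundedBy_of_exp_le (hmono (g := fun z => z.2.1) (by fun_prop)
      fun t ht => ?_) (fun t ht => ?_) ((le_max_left _ _).trans (Real.le_coe_toNNReal _))
    · filter_upwards [GFM.ae_derivData (hy t ht)] with s hs hmem
      exact ⟨_, (hs hmem).zd, by have := D.Γd_pos; positivity⟩
    · have := GFM.exp_gain_le (z := fun t => (y t).2.1) (W := fun t => GFM.Wd Ω D (y t).1)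
        (σ := σ) (ϑ := D.μd * ((1 + Ω.R ^ 2 + (GFM.supNorm vgd : ℝ) ^ 2) / Ω.L ^ 2))
        (τ := (T : ℝ)) ht D.Γd_pos D.ε_pos hσ0
        T.2
        ((hy t ht).absolutelyContinuous_comp (g := fun z : GFM.FullState => z.2.1) (by fun_prop))
        ((hy t ht).absolutelyContinuous_comp (g := fun z : GFM.FullState => GFM.Wd Ω D z.1)
          (by fun_prop))
        (by filter_upwards [GFM.ae_derivData (hy t ht)] with t ht hmem using (ht hmem).zd)
        (fun t _ => GFM.Wd_nonneg _) (fun t ht => (hM ρ _ (hx t ht.1)).1) 𝒥 hJ hdisj hvol (by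
          rw [hunion]
          exact GFM.ae_Wd_deriv_le hd (hy t ht))
      simp only [hy0] at this
      exact this.trans (hcap D.Γd_pos _)
  · refine GFM.gainBoundedBy_of_exp_le (hmono (g := fun z => z.2.2) (by fun_prop)
      fun t ht => ?_) (fun t ht => ?_) ((le_max_right _ _).trans (Real.le_coe_toNNReal _))
    · filter_upwards [GFM.ae_derivData (hy t ht)] with s hs hmem
      exact ⟨_, (hs hmem).zq, by have := D.Γq_pos; positivity⟩
    · have := GFM.exp_gain_le (z := fun t => (y t).2.2) (W := fun t => GFM.Wq Ω D (y t).1)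
        (σ := σ) (ϑ := D.μq * ((1 + Ω.R ^ 2 + (GFM.supNorm vgq : ℝ) ^ 2) / Ω.L ^ 2))
        (τ := (T : ℝ)) ht D.Γq_pos D.ε_pos hσ0
        T.2
        ((hy t ht).absolutelyContinuous_comp (g := fun z : GFM.FullState => z.2.2) (by fun_prop))
        ((hy t ht).absolutelyContinuous_comp (g := fun z : GFM.FullState => GFM.Wq Ω D z.1)
          (by fun_prop))
        (by filter_upwards [GFM.ae_derivData (hy t ht)] with t ht hmem using (ht hmem).zq)
        (fun t _ => GFM.Wq_nonneg _) (fun t ht => (hM ρ _ (hx t ht.1)).2) 𝒥 hJ hdisj hvol (by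
          rw [hunion]
          exact GFM.ae_Wq_deriv_le hq (hy t ht))
      simp only [hy0] at this
      exact this.trans (hcap D.Γq_pos _)
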